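/- Let $h>0$, $\mathbb{H}_h=\{\omega\in\mathbb{C}:\operatorname{Im}\omega>-h\}$, and $f_{\rm exp}\in L^2(0,1)$ (complex valued). Let $\mathcal{K}_h$ be the class of analytic functions $f:\mathbb{H}_h\to\mathbb{C}$ such that $\overline{f(\omega)}=f(-\overline{\omega})$ on $\mathbb{H}_h$; $\operatorname{Im}f(\omega)>0$ whenever $\omega\in\mathbb{H}_h$ and $\operatorname{Re}\omega>0$; and, for some $A>0$, $f(\omega)=-A\omega^{-2}+O(\omega^{-3})$ as $\omega\to\infty$ in $\mathbb{H}_h$. Let $\mathcal{S}_h$ be the closure of $\mathcal{K}_h$ in the space of analytic functions on $\mathbb{H}_h$ with the topology of uniform convergence on compact subsets. A *minimizer* is a function $f_*\in\mathcal{S}_h$ with $\|f_*-f_{\rm exp}\|_{L^2(0,1)}=\min_{f\in\mathcal{S}_h}\|f-f_{\rm exp}\|_{L^2(0,1)}$. The *Caprini function* of $f_*$ is $$C(t)=2\operatorname{Re}\int_0^1\frac{f_*(\omega)-f_{\rm exp}(\omega)}{t-(\omega-ih)^2}\,d\omega,\qquad t\ge 0 .$$ **Theorem 4.6.** Suppose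 that $\inf_{f\in\mathcal{K}_h}\|f-f_{\rm exp}\|_{L^2(0,1)}\neq 0$. Then there is exactly one minimizer $f_*\in\mathcal{S}_h$, and it has the form $$f_*(\omega)=\rho_*+\sum_{j=1}^N\frac{\sigma_j}{t_j-(\omega+ih)^2},\qquad \omega\in\mathbb{H}_h,\tag{1}$$ for some $N\ge 0$, $\rho_*\ge 0$, $\sigma_j>0$ and $0\le t_1<t_2<\dots<t_N$. Moreover, a function $f_*$ of the form (1), with $N$, $\rho_*$, $\sigma_j$, $t_j$ as above, is the minimizer if and only if its Caprini function satisfies $C(t)\ge 0$ for all $t\ge 0$, $C(t_j)=0$ for $j=1,\dots,N$, and, if $\rho_*>0$, $\lim_{t\to\infty}tC(t)=0$. For every $f_*$ of the form (1), $$\lim_{t\to\infty}tC(t)=2\operatorname{Re}\int_0^1\bigl(f_*(\omega)-f_{\rm exp}(\omega)\bigr)\,d\omega ,$$ so the last condition says that this integral has real part zero. -/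

import Mathlib

open Filter Topology MeasureTheory

noncomputable section

namespace Permittivity

/-- The half-plane `ℍ_h = {ω : Im ω > -h}`. -/
def halfPlane (h : ℝ) : Set ℂ := {ω | -h < ω.im}

/-- The class `K_h` of physically admissible functions on `ℍ_h`: analytic, with the symmetry
`conj (f ω) = f (-conj ω)`, the passivity `Im f > 0` where `Re ω > 0`, and the plasma limit
`f ω = -A ω⁻² + O(ω⁻³)` for some `A > 0` as `ω → ∞` in `ℍ_h`.
Only the values of `f` on `ℍ_h` matter. -/
structure IsAdmissible (h : ℝ) (f : ℂ → ℂ) : Prop where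
  analytic : DifferentiableOn ℂ f (halfPlane h)
  symmetry : ∀ ω ∈ halfPlane h, (starRingEnd ℂ) (f ω) = f (-(starRingEnd ℂ) ω)
  passivity : ∀ ω ∈ halfPlane h, 0 < ω.re → 0 < (f ω).im
  plasma : ∃ A : ℝ, 0 < A ∧
    (fun ω : ℂ => f ω - (-(A : ℂ) / ω ^ 2)) =O[Bornology.cobounded ℂ ⊓ 𝓟 (halfPlane h)]
      (fun ω : ℂ => 1 / ω ^ 3)

/-- The class `S_h`: the closure of `K_h` in the space of analytic functions on `ℍ_h` with the
(metrizable) topology of locally uniform convergence. -/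
def IsInClosure (h : ℝ) (f : ℂ → ℂ) : Prop :=
  DifferentiableOn ℂ f (halfPlane h) ∧
    ∃ g : ℕ → ℂ → ℂ, (∀ n, IsAdmissible h (g n)) ∧
      TendstoLocallyUniformlyOn g f atTop (halfPlane h)

/-- The distance `‖f - f_exp‖` in `L²(0,1)`. -/
def l2Dist (f : ℂ → ℂ) (fexp : ℝ → ℂ) : ENNReal :=
  eLpNorm (fun x : ℝ => f (x : ℂ) - fexp x) 2 (volume.restrict (Set.Ioo (0 : ℝ) 1))

/-- `f` minimizes `‖f - f_exp‖` in `L²(0,1)` over `S_h`. -/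
def IsMinimizer (h : ℝ) (fexp : ℝ → ℂ) (f : ℂ → ℂ) : Prop :=
  IsInClosure h f ∧ ∀ g : ℂ → ℂ, IsInClosure h g → l2Dist f fexp ≤ l2Dist g fexp

/-- The function `ρ + ∑ j, σ j / (t j - (ω + i h)²)`. -/
def rationalForm (h : ℝ) {N : ℕ} (ρ : ℝ) (σ t : Fin N → ℝ) (ω : ℂ) : ℂ :=
  (ρ : ℂ) + ∑ j, (σ j : ℂ) / ((t j : ℂ) - (ω + Complex.I * (h : ℂ)) ^ 2)

/-- The parameters allowed in `rationalForm`: `ρ ≥ 0`, `σ j > 0` and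
`0 ≤ t 0 < t 1 < ⋯`. -/
def IsParameter {N : ℕ} (ρ : ℝ) (σ t : Fin N → ℝ) : Prop :=
  0 ≤ ρ ∧ (∀ j, 0 < σ j) ∧ (∀ j, 0 ≤ t j) ∧ StrictMono t

/-- The Caprini function
`C(s) = 2 Re ∫₀¹ (f(ω) - f_exp(ω)) / (s - (ω - i h)²) dω` of `f`. -/
def caprini (h : ℝ) (fexp : ℝ → ℂ) (f : ℂ → ℂ) (s : ℝ) : ℝ :=
  2 * (∫ x in (0 : ℝ)..1,
    (f (x : ℂ) - fexp x) / ((s : ℂ) - ((x : ℂ) - Complex.I * (h : ℂ)) ^ 2)).re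

end Permittivity

end

/-!
The problem is the projection of `f_exp` onto a closed convex cone in `L²(0, 1)`, regarded as a
real Hilbert space with inner product `Re ∫ f conj g`. The cone is the closure of the restrictions
of `K_h`, and the restriction of every function of `S_h` belongs to it (`IsInClosure.toLp_mem`).

*The cone is generated by the kernels.* Put `ζ = ω + i h`. For `f ∈ K_h` and `ε > 0`, the function
`F(ζ) = f(ζ - i h + i ε)` is analytic across the real line and `O(ζ⁻²)`, and Cauchy's formula
together with the symmetry gives `π F(ζ) = ∫ s Im F(s) / (s² - ζ²) ds`
(`HasQuadraticDecay.eq_integral_stieltjes`). By passivity the weight `s Im F(s)` is nonnegative, so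
a vector `q` is nonnegative on the cone if and only if it is nonnegative on all kernels
`1 / (t - ζ²)`, `t ≥ 0` (`inner_nonneg_iff`). For `q = f_* - f_exp` this pairing is half of the
Caprini function, and its value at the constant function `1` is half of the limit of `t C(t)`.

*Characterization.* The point `p` of the cone is the nearest point to `y` if and only if `p - y` is
nonnegative on the cone and orthogonal to `p` (`norm_sub_le_iff_of_cone`). For `p = f_*` rational,
the orthogonality is a vanishing sum of nonnegative terms, namely `ρ lim t C(t)` and `σ_j C(t_j)`.

*Rationality.* Let `p` be the projection and `r = p - f_exp`. In the variable `θ = 1 / (1 + t)`, the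
normalized kernels `1 / (1 - θ (1 + ζ²))`, `0 ≤ θ ≤ 1`, form a compact curve, and the pairing with
`r` is real analytic in `θ`. If it vanished identically, then `r = 0`
(`ae_eq_zero_of_pairing_eq_zero`), and `f_exp` would be a limit of admissible functions. So its zero
set is finite. A Farkas argument (`exists_conicCombination`) then shows that `p`, being orthogonal
to `r`, is a nonnegative combination of the finitely many kernels at the zeros.

*Density of the kernels.* If all pairings of `r` with the kernels vanish, then
`U(ζ - i h) = U(-ζ - i h)` for the Cauchy transform `U = symmCauchy r`. The left side is analytic
below, the right side above the strip `|Im ζ| < h`, so they glue to an entire function vanishing at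
infinity. So `U(v) = 0` for `Im v < 0`, then for `Re v > 1` by the identity theorem, and the values
at real `v > 1` give the moments of `Re r` and `x Im r`.
-/

noncomputable section

namespace Permittivity

/-! ### Cones in a real Hilbert space -/

section Hilbert

variable {H : Type*} [NormedAddCommGroup H] [InnerProductSpace ℝ H]

open scoped RealInnerProductSpace

/-- The functional `e` bounds the coefficients, so near a given point only a compact set of
coefficients matters. -/
theorem isClosed_conicCombination {ι : Type*} (Z : Finset ι) (v : ι → H) (e : H)
    (he : ∀ i ∈ Z, 0 < ⟪e, v i⟫) :
    IsClosed {y : H | ∃ c : ι → ℝ, (∀ i, 0 ≤ c i) ∧ y = ∑ i ∈ Z, c i • v i} := by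
  classical
  rw [← closure_subset_iff_isClosed]
  intro y hy
  set K := {y : H | ∃ c : ι → ℝ, (∀ i, 0 ≤ c i) ∧ y = ∑ i ∈ Z, c i • v i} with hK
  set M := ⟪e, y⟫ + 1 with hM
  let box : Set (ι → ℝ) := Set.univ.pi fun i => Set.Icc 0 (if i ∈ Z then M / ⟪e, v i⟫ else 0)
  have hbox : IsCompact box := isCompact_univ_pi fun i => isCompact_Icc
  have himg : IsCompact ((fun c : ι → ℝ => ∑ i ∈ Z, c i • v i) '' box) :=
    hbox.image (by fun_prop)
  have hopen : IsOpen {z : H | ⟪e, z⟫ < M} := isOpen_lt (by fun_prop) continuous_const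
  have hy' : y ∈ closure ({z : H | ⟪e, z⟫ < M} ∩ K) :=
    hopen.inter_closure ⟨by simp [hM], hy⟩
  have hsub : {z : H | ⟪e, z⟫ < M} ∩ K ⊆ (fun c : ι → ℝ => ∑ i ∈ Z, c i • v i) '' box := by
    rintro z ⟨hz, c, hc, rfl⟩
    refine ⟨fun i => if i ∈ Z then c i else 0, ?_, ?_⟩
    · intro i _
      by_cases hi : i ∈ Z
      · simp only [hi, if_true]
        refine ⟨hc i, ?_⟩
        rw [le_div_iff₀ (he i hi)]
        have h1 : c i * ⟪e, v i⟫ ≤ ∑ j ∈ Z, c j * ⟪e, v j⟫ :=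
          Finset.single_le_sum (f := fun j => c j * ⟪e, v j⟫)
            (fun j hj => mul_nonneg (hc j) (he j hj).le) hi
        have h2 : ⟪e, ∑ j ∈ Z, c j • v j⟫ = ∑ j ∈ Z, c j * ⟪e, v j⟫ := by
          simp [inner_sum, inner_smul_right]
        have h3 : ⟪e, ∑ j ∈ Z, c j • v j⟫ < M := hz
        linarith
      · simp [hi]
    · exact Finset.sum_congr rfl fun i hi => by simp [hi]
  obtain ⟨c, hc, rfl⟩ := closure_minimal hsub himg.isClosed hy'
  exact ⟨c, fun i => (hc i trivial).1, rfl⟩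

/-- The closed cone of nonnegative combinations of the finitely many vectors `v i`, `i ∈ Z`. The
vector `e`, positive on all of them, serves to prove closedness. -/
def finiteCone {ι : Type*} (Z : Finset ι) (v : ι → H) (e : H)
    (he : ∀ i ∈ Z, 0 < ⟪e, v i⟫) : ProperCone ℝ H where
  carrier := {y : H | ∃ c : ι → ℝ, (∀ i, 0 ≤ c i) ∧ y = ∑ i ∈ Z, c i • v i}
  add_mem' := by
    rintro _ _ ⟨c, hc, rfl⟩ ⟨d, hd, rfl⟩
    exact ⟨c + d, fun i => add_nonneg (hc i) (hd i), by simp [add_smul, Finset.sum_add_distrib]⟩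
  zero_mem' := ⟨0, fun _ => le_rfl, by simp⟩
  smul_mem' := by
    rintro a _ ⟨c, hc, rfl⟩
    refine ⟨fun i => a * c i, fun i => mul_nonneg a.2 (hc i), ?_⟩
    rw [Finset.smul_sum]
    exact Finset.sum_congr rfl fun i _ => by rw [← smul_smul]; rfl
  isClosed' := isClosed_conicCombination Z v e he

/-- Let `p` belong to the closed cone generated by a compact family `κ`, in the form of the dual
condition `hdual`. If `r` is nonnegative on the family and orthogonal to `p`, then `p` is a
combination of the members on which `r` vanishes, as long as they are finitely many. Otherwise
some `q` is nonnegative on these members and negative at `p`; adding a small multiple of `e` and a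
large multiple of `r` makes it positive on the whole family without making it nonnegative at
`p`. -/
theorem exists_conicCombination [CompleteSpace H] {X : Type*} [TopologicalSpace X]
    [CompactSpace X] (κ : X → H) (hκ : Continuous κ) (p r e : H)
    (hdual : ∀ q : H, (∀ x, 0 ≤ ⟪q, κ x⟫) → 0 ≤ ⟪q, p⟫)
    (hr : ∀ x, 0 ≤ ⟪r, κ x⟫) (hrp : ⟪r, p⟫ = 0) (he : ∀ x, 0 < ⟪e, κ x⟫)
    (Z : Finset X) (hZ : ∀ x, ⟪r, κ x⟫ = 0 → x ∈ Z) :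
    ∃ c : X → ℝ, (∀ x, 0 ≤ c x) ∧ p = ∑ x ∈ Z, c x • κ x := by
  by_contra hcon
  have hp : p ∉ finiteCone Z κ e (fun x _ => he x) := hcon
  obtain ⟨q, hq, hqp⟩ := ProperCone.hyperplane_separation' _ hp
  have hqZ : ∀ x ∈ Z, 0 ≤ ⟪q, κ x⟫ := by
    classical
    intro x hx
    rw [real_inner_comm]
    refine hq _ ⟨fun y => if y = x then 1 else 0, fun y => by positivity, ?_⟩
    simp [hx]
  rw [real_inner_comm] at hqp
  obtain ⟨δ, hδ, hδp⟩ : ∃ δ : ℝ, 0 < δ ∧ ⟪q, p⟫ + δ * ⟪e, p⟫ < 0 := by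
    have : ∀ᶠ δ in 𝓝[>] (0 : ℝ), ⟪q, p⟫ + δ * ⟪e, p⟫ < 0 := by
      have : Tendsto (fun δ : ℝ => ⟪q, p⟫ + δ * ⟪e, p⟫) (𝓝 0) (𝓝 (⟪q, p⟫ + 0 * ⟪e, p⟫)) :=
        Continuous.tendsto (by fun_prop) 0
      rw [zero_mul, add_zero] at this
      exact (this.eventually_lt_const hqp).filter_mono nhdsWithin_le_nhds
    obtain ⟨δ, h1, h2⟩ := (this.and self_mem_nhdsWithin).exists
    exact ⟨δ, h2, h1⟩
  -- the open sets where `q + δ e + n r` is positive exhaust the compact space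
  obtain ⟨n, hn⟩ : ∃ n : ℕ, ∀ x, 0 ≤ ⟪q, κ x⟫ + δ * ⟪e, κ x⟫ + n * ⟪r, κ x⟫ := by
    have hcov : (Set.univ : Set X) ⊆
        ⋃ n : ℕ, {x | 0 < ⟪q, κ x⟫ + δ * ⟪e, κ x⟫ + n * ⟪r, κ x⟫} := by
      intro x _
      rw [Set.mem_iUnion]
      rcases (hr x).eq_or_lt with h0 | h0
      · have := hqZ x (hZ x h0.symm)
        have := mul_pos hδ (he x)
        exact ⟨0, by simp only [Set.mem_ofPred_eq, Nat.cast_zero, zero_mul]; linarith⟩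
      · obtain ⟨n, hn⟩ := exists_nat_gt (-(⟪q, κ x⟫ + δ * ⟪e, κ x⟫) / ⟪r, κ x⟫)
        rw [div_lt_iff₀ h0] at hn
        exact ⟨n, by simp only [Set.mem_ofPred_eq]; linarith⟩
    obtain ⟨t, ht⟩ := isCompact_univ.elim_finite_subcover _
      (fun n => isOpen_lt continuous_const (by fun_prop)) hcov
    refine ⟨t.sup id, fun x => ?_⟩
    obtain ⟨n, hn, hx⟩ := Set.mem_iUnion₂.1 (ht (Set.mem_univ x))
    have h1 : (n : ℝ) ≤ (t.sup id : ℕ) := by exact_mod_cast Finset.le_sup (f := id) hn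
    have h2 := mul_le_mul_of_nonneg_right h1 (hr x)
    simp only [Set.mem_ofPred_eq] at hx
    linarith
  have := hdual (q + δ • e + (n : ℝ) • r) fun x => by
    simpa only [inner_add_left, real_inner_smul_left] using hn x
  simp only [inner_add_left, real_inner_smul_left, hrp, mul_zero, add_zero] at this
  linarith

/-- The variational inequality for the nearest point of a convex cone. -/
theorem norm_sub_le_iff_of_cone {K : Set H} (hK : Convex ℝ K)
    (hsmul : ∀ a : ℝ, 0 < a → ∀ z ∈ K, a • z ∈ K) {p : H} (hp : p ∈ K) (y : H) :
    (∀ z ∈ K, ‖p - y‖ ≤ ‖z - y‖) ↔ (∀ z ∈ K, 0 ≤ ⟪p - y, z⟫) ∧ ⟪p - y, p⟫ = 0 := by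
  have key : (∀ z ∈ K, ‖p - y‖ ≤ ‖z - y‖) ↔ ∀ z ∈ K, 0 ≤ ⟪p - y, z - p⟫ := by
    have h1 := norm_eq_iInf_iff_real_inner_le_zero hK (u := y) hp
    have h2 : (∀ z ∈ K, ⟪y - p, z - p⟫ ≤ 0) ↔ ∀ z ∈ K, 0 ≤ ⟪p - y, z - p⟫ := by
      refine forall₂_congr fun z _ => ?_
      rw [← neg_sub p y, inner_neg_left, neg_nonpos]
    rw [← h2, ← h1]
    have hne : Nonempty K := ⟨⟨p, hp⟩⟩
    have hbdd : BddBelow (Set.range fun w : K => ‖y - w‖) :=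
      ⟨0, by rintro _ ⟨w, rfl⟩; exact norm_nonneg _⟩
    constructor
    · intro h
      refine le_antisymm (le_ciInf fun w => ?_) (ciInf_le hbdd ⟨p, hp⟩)
      rw [norm_sub_rev, norm_sub_rev y]
      exact h w w.2
    · intro h z hz
      rw [norm_sub_rev, norm_sub_rev z, h]
      exact ciInf_le hbdd ⟨z, hz⟩
  rw [key]
  constructor
  · intro h
    have h0 : ⟪p - y, p⟫ = 0 := by
      have h1 := h _ (hsmul 2 two_pos p hp)
      have h2 := h _ (hsmul (1 / 2) (by norm_num) p hp)
      rw [inner_sub_right, real_inner_smul_right] at h1 h2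
      linarith
    exact ⟨fun z hz => by simpa [inner_sub_right, h0] using h z hz, h0⟩
  · rintro ⟨h, h0⟩ z hz
    rw [inner_sub_right, h0, sub_zero]
    exact h z hz

theorem eq_of_norm_sub_le {K : Set H} (hK : Convex ℝ K) {p q : H} (hp : p ∈ K) (hq : q ∈ K) (y : H)
    (h1 : ∀ z ∈ K, ‖p - y‖ ≤ ‖z - y‖) (h2 : ∀ z ∈ K, ‖q - y‖ ≤ ‖z - y‖) : p = q := by
  have hm : (1 / 2 : ℝ) • p + (1 / 2 : ℝ) • q ∈ K := hK hp hq (by norm_num) (by norm_num) (by norm_num)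
  have h3 := h1 _ hm
  have h4 : ‖p - y‖ = ‖q - y‖ := le_antisymm (h1 _ hq) (h2 _ hp)
  have h5 := parallelogram_law_with_norm ℝ (p - y) (q - y)
  have h6 : (p - y) + (q - y) = (2 : ℝ) • (((1 / 2 : ℝ) • p + (1 / 2 : ℝ) • q) - y) := by
    module
  rw [h6, norm_smul, sub_sub_sub_cancel_right, Real.norm_two, ← h4] at h5
  have h7 : ‖p - q‖ = 0 := by
    have := norm_nonneg (p - y)
    have := norm_nonneg (p - q)
    nlinarith
  exact sub_eq_zero.1 (norm_eq_zero.1 h7)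

end Hilbert

/-! ### The kernels and the two classes of functions -/

/-- A bound for `(1 + s) / |s - (x + i h)²|` over `s ≥ 0` and `|x| ≤ 1`. -/
def kernelBound (h : ℝ) : ℝ := 2 + 3 / h ^ 2

/-- The generating function `1 / (s - (ω + i h)²)` of the classes, where `s ≥ 0`. -/
def stieltjesKernel (h s : ℝ) (ω : ℂ) : ℂ := 1 / ((s : ℂ) - (ω + Complex.I * (h : ℂ)) ^ 2)

/-- The normalized kernel `1 / (1 - θ (1 + (ω + i h)²))`, which is
`(1 + s) / (s - (ω + i h)²)` for `θ = 1 / (1 + s)` and the constant `1`, the limit as `s → ∞`, for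
`θ = 0`. -/
def unitKernel (h θ : ℝ) (ω : ℂ) : ℂ := 1 / (1 - (θ : ℂ) * (1 + (ω + Complex.I * (h : ℂ)) ^ 2))

theorem kernelBound_pos (h : ℝ) : 0 < kernelBound h := by unfold kernelBound; positivity

theorem one_le_kernelBound (h : ℝ) : 1 ≤ kernelBound h := by
  have : 0 ≤ 3 / h ^ 2 := by positivity
  unfold kernelBound; linarith

theorem ofReal_mem_halfPlane {h : ℝ} (hh : 0 < h) (x : ℝ) : (x : ℂ) ∈ halfPlane h := by
  simpa [halfPlane] using hh

theorem isOpen_halfPlane (h : ℝ) : IsOpen (halfPlane h) :=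
  isOpen_lt continuous_const Complex.continuous_im

theorem convex_halfPlane (h : ℝ) : Convex ℝ (halfPlane h) :=
  convex_halfSpace_im_gt _

/-- Both factors of `s - z² = (√s - z) (√s + z)` are bounded below by a multiple of `√(1 + s)`
when `|Re z| ≤ 1` and `|Im z| = h`. -/
theorem one_add_le_kernelBound_mul {h : ℝ} (hh : 0 < h) {z : ℂ} (hre : |z.re| ≤ 1)
    (him : |z.im| = h) {s : ℝ} (hs : 0 ≤ s) : 1 + s ≤ kernelBound h * ‖(s : ℂ) - z ^ 2‖ := by
  have hx2 : z.re ^ 2 ≤ 1 := by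
    have := abs_le.1 hre
    nlinarith
  have hy2 : z.im ^ 2 = h ^ 2 := by rw [← sq_abs, him]
  have hB := kernelBound_pos h
  have key : ∀ a : ℝ, a ^ 2 = s → 1 + s ≤ kernelBound h * ‖(a : ℂ) - z‖ ^ 2 := by
    intro a ha
    have h1 : ‖(a : ℂ) - z‖ ^ 2 = (a - z.re) ^ 2 + h ^ 2 := by
      rw [← Complex.normSq_eq_norm_sq, Complex.normSq_apply]
      simp [← hy2]; ring
    rw [h1]
    have h2 : kernelBound h * ((a - z.re) ^ 2 + h ^ 2)
        = 2 * (a - z.re) ^ 2 + 2 * h ^ 2 + 3 / h ^ 2 * (a - z.re) ^ 2 + 3 := by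
      unfold kernelBound; field_simp; ring
    rw [h2]
    have : 0 ≤ 3 / h ^ 2 * (a - z.re) ^ 2 := by positivity
    nlinarith [sq_nonneg (a - 2 * z.re), sq_nonneg h]
  set a := √s
  have ha : a ^ 2 = s := Real.sq_sqrt hs
  have h1 := key a ha
  have h2 := key (-a) (by rw [neg_sq, ha])
  have h3 : ‖(s : ℂ) - z ^ 2‖ = ‖(a : ℂ) - z‖ * ‖((-a : ℝ) : ℂ) - z‖ := by
    rw [← norm_mul, ← norm_neg, ← ha]
    congr 1
    push_cast; ring
  rw [h3]
  refine abs_le_of_sq_le_sq' (b := kernelBound h * (‖(a : ℂ) - z‖ * ‖((-a : ℝ) : ℂ) - z‖)) ?_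
    (by positivity) |>.2
  calc (1 + s) ^ 2 = (1 + s) * (1 + s) := sq _
    _ ≤ (kernelBound h * ‖(a : ℂ) - z‖ ^ 2) * (kernelBound h * ‖((-a : ℝ) : ℂ) - z‖ ^ 2) := by
        gcongr
    _ = _ := by ring

theorem one_le_kernelBound_mul {h : ℝ} (hh : 0 < h) {z : ℂ} (hre : |z.re| ≤ 1)
    (him : |z.im| = h) {θ : ℝ} (hθ : θ ∈ Set.Icc (0 : ℝ) 1) :
    1 ≤ kernelBound h * ‖1 - (θ : ℂ) * (1 + z ^ 2)‖ := by
  rcases hθ.1.eq_or_lt with rfl | h0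
  · simpa using one_le_kernelBound h
  · have h1 := one_add_le_kernelBound_mul hh hre him (s := 1 / θ - 1)
      (by rw [sub_nonneg, le_div_iff₀ h0]; linarith [hθ.2])
    have hθ' : (θ : ℂ) ≠ 0 := by exact_mod_cast h0.ne'
    have h2 : 1 - (θ : ℂ) * (1 + z ^ 2) = θ * (((1 / θ - 1 : ℝ) : ℂ) - z ^ 2) := by
      push_cast; field_simp; ring
    rw [h2, norm_mul, Complex.norm_real, Real.norm_of_nonneg h0.le]
    have h3 := mul_le_mul_of_nonneg_left h1 h0.le
    have h4 : θ * (1 + (1 / θ - 1)) = 1 := by field_simp; ring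
    linarith

theorem stieltjes_denom_ne_zero {s : ℝ} (hs : 0 ≤ s) {z : ℂ} (hz : z.im ≠ 0) :
    (s : ℂ) - z ^ 2 ≠ 0 := by
  rw [← Real.sq_sqrt hs]
  push_cast
  rw [sq_sub_sq]
  refine mul_ne_zero (fun h => hz ?_) (fun h => hz ?_)
  · have := congrArg Complex.im h
    simpa using this
  · have := congrArg Complex.im h
    simpa using this

theorem unitKernel_zero (h : ℝ) (ω : ℂ) : unitKernel h 0 ω = 1 := by simp [unitKernel]

theorem unitKernel_eq {h θ : ℝ} (hθ : 0 < θ) (ω : ℂ) :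
    unitKernel h θ ω = (1 / θ : ℝ) * stieltjesKernel h (1 / θ - 1) ω := by
  have hθ' : (θ : ℂ) ≠ 0 := by exact_mod_cast hθ.ne'
  unfold unitKernel stieltjesKernel
  rw [Complex.ofReal_div, Complex.ofReal_one, div_mul_div_comm, one_mul]
  congr 1
  push_cast; field_simp; ring

theorem unitKernel_one_div {h s : ℝ} (hs : 0 ≤ s) (ω : ℂ) :
    unitKernel h (1 / (1 + s)) ω = (1 + s : ℝ) * stieltjesKernel h s ω := by
  rw [unitKernel_eq (by positivity)]
  simp

theorem im_add_I_mul (h : ℝ) (ω : ℂ) : (ω + Complex.I * (h : ℂ)).im = ω.im + h := by simp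

theorem IsAdmissible.add {h : ℝ} {f g : ℂ → ℂ} (hf : IsAdmissible h f) (hg : IsAdmissible h g) :
    IsAdmissible h (f + g) where
  analytic := hf.analytic.add hg.analytic
  symmetry ω hω := by simp [hf.symmetry ω hω, hg.symmetry ω hω]
  passivity ω hω h0 := add_pos (hf.passivity ω hω h0) (hg.passivity ω hω h0)
  plasma := by
    obtain ⟨A, hA, h1⟩ := hf.plasma
    obtain ⟨B, hB, h2⟩ := hg.plasma
    refine ⟨A + B, add_pos hA hB, (h1.add h2).congr_left fun ω => ?_⟩
    simp only [Pi.add_apply]; push_cast; ring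

theorem IsAdmissible.smul {h : ℝ} {f : ℂ → ℂ} (hf : IsAdmissible h f) {a : ℝ} (ha : 0 < a) :
    IsAdmissible h (fun ω => (a : ℂ) * f ω) where
  analytic := hf.analytic.const_mul _
  symmetry ω hω := by simp [hf.symmetry ω hω]
  passivity ω hω h0 := by
    rw [Complex.im_ofReal_mul]
    exact mul_pos ha (hf.passivity ω hω h0)
  plasma := by
    obtain ⟨A, hA, h1⟩ := hf.plasma
    refine ⟨a * A, mul_pos ha hA, (h1.const_mul_left (a : ℂ)).congr_left fun ω => ?_⟩
    push_cast; ring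

theorem isAdmissible_stieltjesKernel {h : ℝ} (hh : 0 < h) {s : ℝ} (hs : 0 ≤ s) :
    IsAdmissible h (stieltjesKernel h s) where
  analytic := by
    refine DifferentiableOn.div (by fun_prop) (by fun_prop) fun ω hω => ?_
    exact stieltjes_denom_ne_zero hs (by
      rw [im_add_I_mul]; have : -h < ω.im := hω; linarith)
  symmetry ω hω := by
    simp only [stieltjesKernel, map_div₀, map_sub, map_pow, map_add, map_mul, map_one,
      Complex.conj_I, Complex.conj_ofReal]
    congr 2; ring
  passivity ω hω h0 := by
    have h1 : -h < ω.im := hω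
    have hne := stieltjes_denom_ne_zero hs (z := ω + Complex.I * (h : ℂ)) (by
      rw [im_add_I_mul]; linarith)
    rw [stieltjesKernel, one_div, Complex.inv_im]
    refine div_pos ?_ (Complex.normSq_pos.2 hne)
    simp [sq]
    nlinarith
  plasma := by
    refine ⟨1, one_pos, ?_⟩
    have : ∀ᶠ ω : ℂ in Bornology.cobounded ℂ ⊓ 𝓟 (halfPlane h),
        ‖stieltjesKernel h s ω - (-((1 : ℝ) : ℂ) / ω ^ 2)‖ ≤ (8 * (2 * h + s + h ^ 2)) * ‖1 / ω ^ 3‖ := by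
      refine Filter.Eventually.filter_mono inf_le_left ?_
      filter_upwards [(tendsto_norm_cobounded_atTop (E := ℂ)).eventually_ge_atTop
        (1 + 2 * (2 * h + s + h ^ 2))] with ω hω
      set R := ‖ω‖
      have hK : 0 < 2 * h + s + h ^ 2 := by positivity
      have hR : 1 ≤ R := by linarith
      have hω0 : ω ≠ 0 := norm_pos_iff.1 (by linarith)
      set d : ℂ := (s : ℂ) - (2 * Complex.I * h * ω - h ^ 2) with hd
      have hden : (s : ℂ) - (ω + Complex.I * (h : ℂ)) ^ 2 = d - ω ^ 2 := by
        rw [hd]; ring_nf; simp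
      have hdn : ‖d‖ ≤ (2 * h + s + h ^ 2) * R := by
        calc ‖d‖ ≤ ‖(s : ℂ)‖ + (‖2 * Complex.I * h * ω‖ + ‖(h : ℂ) ^ 2‖) :=
              (norm_sub_le _ _).trans (by gcongr; exact norm_sub_le _ _)
          _ = s + (2 * h * R + h ^ 2) := by
              simp [abs_of_nonneg hs, abs_of_pos hh, R]
          _ ≤ _ := by nlinarith [sq_nonneg h]
      have hden2 : R ^ 2 / 2 ≤ ‖d - ω ^ 2‖ := by
        have := norm_sub_norm_le (ω ^ 2) d
        rw [norm_sub_rev (ω ^ 2) d, norm_pow] at this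
        change R ^ 2 - _ ≤ _ at this
        nlinarith
      have hden0 : d - ω ^ 2 ≠ 0 := norm_pos_iff.1 (by nlinarith)
      have heq : stieltjesKernel h s ω - (-((1 : ℝ) : ℂ) / ω ^ 2) = d / ((d - ω ^ 2) * ω ^ 2) := by
        rw [stieltjesKernel, hden]; push_cast; field_simp; ring
      rw [heq, norm_div, norm_mul, norm_div, norm_pow, norm_pow, norm_one]
      change _ / (_ * R ^ 2) ≤ _ * (1 / R ^ 3)
      have hR0 : 0 < R := by linarith
      rw [div_le_iff₀ (by positivity)]
      calc ‖d‖ ≤ (2 * h + s + h ^ 2) * R := hdn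
        _ ≤ 8 * (2 * h + s + h ^ 2) * (1 / R ^ 3) * (R ^ 2 / 2 * R ^ 2) := by
            field_simp; nlinarith [mul_pos hK hR0]
        _ ≤ _ := by gcongr
    exact Asymptotics.IsBigO.of_bound _ this

theorem IsAdmissible.isInClosure {h : ℝ} {f : ℂ → ℂ} (hf : IsAdmissible h f) :
    IsInClosure h f :=
  ⟨hf.analytic, fun _ => f, fun _ => hf, fun _ hu _ _ =>
    ⟨Set.univ, Filter.univ_mem, Eventually.of_forall fun _ _ _ => refl_mem_uniformity hu⟩⟩

theorem IsInClosure.add {h : ℝ} {f g : ℂ → ℂ} (hf : IsInClosure h f) (hg : IsInClosure h g) :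
    IsInClosure h (f + g) := by
  obtain ⟨hf0, u, hu, hu'⟩ := hf
  obtain ⟨hg0, v, hv, hv'⟩ := hg
  exact ⟨hf0.add hg0, fun n => u n + v n, fun n => (hu n).add (hv n), hu'.add hv'⟩

theorem IsInClosure.smul {h : ℝ} {f : ℂ → ℂ} (hf : IsInClosure h f) {a : ℝ} (ha : 0 < a) :
    IsInClosure h (fun ω => (a : ℂ) * f ω) := by
  obtain ⟨hf0, u, hu, hu'⟩ := hf
  refine ⟨hf0.const_mul _, fun n ω => (a : ℂ) * u n ω, fun n => (hu n).smul ha, ?_⟩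
  exact (uniformContinuous_const_smul (a : ℂ)).comp_tendstoLocallyUniformlyOn hu'

/-- A limit with rate `1 / (n + 1)` on bounded sets is locally uniform. -/
theorem tendstoLocallyUniformlyOn_of_bound {U : Set ℂ} {f : ℂ → ℂ} {g : ℕ → ℂ → ℂ} (b : ℂ → ℝ)
    (hb : ContinuousOn b U) (hU : IsOpen U)
    (hg : ∀ n : ℕ, ∀ ω ∈ U, b ω ≤ (n + 1 : ℝ) → ‖g n ω - f ω‖ ≤ b ω / (n + 1)) :
    TendstoLocallyUniformlyOn g f atTop U := by
  rw [tendstoLocallyUniformlyOn_iff_forall_isCompact hU]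
  intro K hKU hK
  rw [Metric.tendstoUniformlyOn_iff]
  intro ε hε
  obtain ⟨M, hM⟩ := (hK.image_of_continuousOn (hb.mono hKU)).bddAbove
  have h1 : Tendsto (fun n : ℕ => (n : ℝ) + 1) atTop atTop :=
    tendsto_atTop_add_const_right _ _ tendsto_natCast_atTop_atTop
  filter_upwards [h1.eventually_ge_atTop M, h1.eventually_gt_atTop (M / ε)] with n h2 h3 ω hω
  have hbM : b ω ≤ M := hM ⟨ω, hω, rfl⟩
  rw [dist_comm, dist_eq_norm]
  refine (hg n ω (hKU hω) (hbM.trans h2)).trans_lt ?_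
  rw [div_lt_iff₀ hε] at h3
  rw [div_lt_iff₀ (by positivity)]
  linarith

/-- The zero function is not admissible, but it is the limit of small multiples of a kernel. -/
theorem isInClosure_zero {h : ℝ} (hh : 0 < h) : IsInClosure h (fun _ => 0) := by
  have hk := isAdmissible_stieltjesKernel hh le_rfl
  refine ⟨differentiableOn_const _, fun n ω => ((1 / (n + 1) : ℝ) : ℂ) * stieltjesKernel h 0 ω,
    fun n => hk.smul (by positivity), ?_⟩
  refine tendstoLocallyUniformlyOn_of_bound (fun ω => ‖stieltjesKernel h 0 ω‖)
    hk.analytic.continuousOn.norm (isOpen_halfPlane h) fun n ω _ _ => ?_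
  rw [sub_zero, norm_mul, Complex.norm_real, Real.norm_of_nonneg (by positivity)]
  exact le_of_eq (by ring)

/-- The constant `1` is the limit of `(1 + n) / (n - (ω + i h)²)`. -/
theorem isInClosure_one {h : ℝ} (hh : 0 < h) : IsInClosure h (fun _ => 1) := by
  refine ⟨differentiableOn_const _, fun n => unitKernel h (1 / (1 + (n : ℝ))), fun n => ?_, ?_⟩
  · have hk := isAdmissible_stieltjesKernel hh (Nat.cast_nonneg (α := ℝ) n)
    have := hk.smul (a := 1 + n) (by positivity)
    convert this using 2 with ω
    exact unitKernel_one_div (Nat.cast_nonneg n) ω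
  refine tendstoLocallyUniformlyOn_of_bound (fun ω => 2 * ‖1 + (ω + Complex.I * (h : ℂ)) ^ 2‖)
    (by fun_prop) (isOpen_halfPlane h) fun n ω _ hb => ?_
  set w := 1 + (ω + Complex.I * (h : ℂ)) ^ 2
  set θ : ℝ := 1 / (1 + (n : ℝ)) with hθ
  have hθ0 : 0 < θ := by positivity
  have h1 : ‖(θ : ℂ) * w‖ = ‖w‖ / (n + 1) := by
    rw [norm_mul, Complex.norm_real, Real.norm_of_nonneg hθ0.le, hθ]; ring
  have h2 : ‖(θ : ℂ) * w‖ ≤ 1 / 2 := by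
    rw [h1, div_le_iff₀ (by positivity)]; linarith
  have h3 : 1 / 2 ≤ ‖1 - (θ : ℂ) * w‖ := by
    have := norm_sub_norm_le 1 ((θ : ℂ) * w)
    rw [norm_one] at this
    linarith
  have h4 : 1 - (θ : ℂ) * w ≠ 0 := norm_pos_iff.1 (by linarith)
  have h5 : unitKernel h θ ω - 1 = (θ : ℂ) * w / (1 - (θ : ℂ) * w) := by
    change 1 / (1 - (θ : ℂ) * w) - 1 = _
    field_simp; ring
  rw [h5, norm_div, h1, div_le_iff₀ (by linarith)]
  have : 0 ≤ ‖w‖ / (n + 1) := by positivity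
  calc ‖w‖ / (n + 1) = 2 * ‖w‖ / (n + 1) * (1 / 2) := by ring
    _ ≤ _ := by gcongr

theorem IsInClosure.smul_nonneg {h : ℝ} (hh : 0 < h) {f : ℂ → ℂ} (hf : IsInClosure h f) {a : ℝ}
    (ha : 0 ≤ a) : IsInClosure h (fun ω => (a : ℂ) * f ω) := by
  rcases ha.eq_or_lt with rfl | ha
  · simpa using isInClosure_zero hh
  · exact hf.smul ha

theorem isInClosure_unitKernel {h : ℝ} (hh : 0 < h) {θ : ℝ} (hθ : θ ∈ Set.Icc (0 : ℝ) 1) :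
    IsInClosure h (unitKernel h θ) := by
  rcases hθ.1.eq_or_lt with rfl | h0
  · simpa [funext (unitKernel_zero h)] using isInClosure_one hh
  · rw [funext (unitKernel_eq (h := h) h0)]
    refine (isAdmissible_stieltjesKernel hh ?_).isInClosure.smul (by positivity)
    rw [sub_nonneg, le_div_iff₀ h0]; linarith [hθ.2]

theorem isInClosure_sum {h : ℝ} (hh : 0 < h) {ι : Type*} (Z : Finset ι) (f : ι → ℂ → ℂ)
    (hf : ∀ i ∈ Z, IsInClosure h (f i)) : IsInClosure h (fun ω => ∑ i ∈ Z, f i ω) := by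
  classical
  induction Z using Finset.induction_on with
  | empty => simpa using isInClosure_zero hh
  | insert i Z hi ih =>
    have h1 := (hf i (Finset.mem_insert_self i Z)).add
      (ih fun j hj => hf j (Finset.mem_insert_of_mem hj))
    convert h1 using 2 with ω
    simp [Finset.sum_insert hi]

theorem rationalForm_eq (h : ℝ) {N : ℕ} (ρ : ℝ) (σ t : Fin N → ℝ) (ω : ℂ) :
    rationalForm h ρ σ t ω = ρ + ∑ j, (σ j : ℂ) * stieltjesKernel h (t j) ω := by
  simp [rationalForm, stieltjesKernel, div_eq_mul_inv]

theorem isInClosure_rationalForm {h : ℝ} (hh : 0 < h) {N : ℕ} {ρ : ℝ} {σ t : Fin N → ℝ}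
    (hp : IsParameter ρ σ t) : IsInClosure h (rationalForm h ρ σ t) := by
  obtain ⟨hρ, hσ, ht, -⟩ := hp
  have h1 := (isInClosure_one hh).smul_nonneg hh hρ
  have h2 := isInClosure_sum hh Finset.univ (fun j ω => (σ j : ℂ) * stieltjesKernel h (t j) ω)
    fun j _ => (isAdmissible_stieltjesKernel hh (ht j)).isInClosure.smul (hσ j)
  convert h1.add h2 using 1
  ext ω
  simp [rationalForm_eq]

/-! ### Restriction to the unit interval -/

/-- Lebesgue measure on `(0, 1)`. -/
abbrev unitMeasure : Measure ℝ := volume.restrict (Set.Ioo (0 : ℝ) 1)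

/-- The space `L²(0, 1)` of complex functions; it is used as a Hilbert space over `ℝ`, with the
inner product `Re ∫ f conj g`. -/
abbrev L2Unit : Type := Lp ℂ 2 unitMeasure

theorem ae_unitMeasure_mem : ∀ᵐ x ∂unitMeasure, x ∈ Set.Ioo (0 : ℝ) 1 :=
  ae_restrict_mem measurableSet_Ioo

theorem intervalIntegral_eq_unitMeasure (f : ℝ → ℂ) :
    ∫ x in (0 : ℝ)..1, f x = ∫ x, f x ∂unitMeasure := by
  rw [intervalIntegral.integral_of_le zero_le_one, integral_Ioc_eq_integral_Ioo]

theorem continuousOn_comp_ofReal {h : ℝ} (hh : 0 < h) {f : ℂ → ℂ}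
    (hf : ContinuousOn f (halfPlane h)) : Continuous (fun x : ℝ => f (x : ℂ)) :=
  hf.comp_continuous Complex.continuous_ofReal fun x => ofReal_mem_halfPlane hh x

theorem memLp_of_continuous {f : ℝ → ℂ} (hf : Continuous f) (p : ENNReal) :
    MemLp f p unitMeasure := by
  obtain ⟨M, hM⟩ := (isCompact_Icc.image (s := Set.Icc (0 : ℝ) 1) hf.norm).bddAbove
  refine MemLp.of_bound hf.aestronglyMeasurable M ?_
  filter_upwards [ae_unitMeasure_mem] with x hx
  exact hM ⟨x, Set.Ioo_subset_Icc_self hx, rfl⟩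

theorem IsInClosure.memLp {h : ℝ} (hh : 0 < h) {f : ℂ → ℂ} (hf : IsInClosure h f) :
    MemLp (fun x : ℝ => f (x : ℂ)) 2 unitMeasure :=
  memLp_of_continuous (continuousOn_comp_ofReal hh hf.1.continuousOn) 2

theorem inner_L2Unit (p q : L2Unit) :
    inner ℝ p q = (∫ x, p x * (starRingEnd ℂ) (q x) ∂unitMeasure).re := by
  have h1 : Integrable (fun x => inner ℂ (q x) (p x)) unitMeasure := L2.integrable_inner q p
  have h2 : inner ℝ p q = ∫ x, inner ℝ (p x) (q x) ∂unitMeasure := L2.inner_def p q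
  rw [h2]
  rw [← RCLike.re_eq_complex_re, ← integral_re]
  · refine integral_congr_ae (Eventually.of_forall fun x => ?_)
    simp
    ring
  · simpa [RCLike.inner_apply] using h1

theorem inner_L2Unit_of_ae {p q : L2Unit} {f g : ℝ → ℂ} (hf : p =ᵐ[unitMeasure] f)
    (hg : q =ᵐ[unitMeasure] g) :
    inner ℝ p q = (∫ x, f x * (starRingEnd ℂ) (g x) ∂unitMeasure).re := by
  rw [inner_L2Unit]
  congr 1
  refine integral_congr_ae ?_
  filter_upwards [hf, hg] with x h1 h2
  rw [h1, h2]

/-- Functions of `S_h` are continuous on `[0, 1]`, so the distance is finite. -/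
theorem l2Dist_eq {h : ℝ} (hh : 0 < h) {f : ℂ → ℂ} (hf : IsInClosure h f) {fexp : ℝ → ℂ}
    (hfexp : MemLp fexp 2 unitMeasure) :
    l2Dist f fexp = ENNReal.ofReal ‖(hf.memLp hh).toLp - hfexp.toLp‖ := by
  rw [← MemLp.toLp_sub, Lp.norm_toLp, ENNReal.ofReal_toReal ((hf.memLp hh).sub hfexp).2.ne]
  rfl

/-- The restrictions of the class `K_h` to `(0, 1)`. -/
def admissibleTraces (h : ℝ) : Set L2Unit :=
  {p | ∃ g, IsAdmissible h g ∧ p =ᵐ[unitMeasure] fun x : ℝ => g (x : ℂ)}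

theorem smul_mem_admissibleTraces {h a : ℝ} (ha : 0 < a) {p : L2Unit}
    (hp : p ∈ admissibleTraces h) : a • p ∈ admissibleTraces h := by
  obtain ⟨g, hg, hpg⟩ := hp
  refine ⟨_, hg.smul ha, ?_⟩
  filter_upwards [Lp.coeFn_smul a p, hpg] with x h1 h2
  rw [h1, Pi.smul_apply, h2, Complex.real_smul]

theorem add_mem_admissibleTraces {h : ℝ} {p q : L2Unit}
    (hp : p ∈ admissibleTraces h) (hq : q ∈ admissibleTraces h) : p + q ∈ admissibleTraces h := by
  obtain ⟨g, hg, hpg⟩ := hp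
  obtain ⟨k, hk, hqk⟩ := hq
  refine ⟨_, hg.add hk, ?_⟩
  filter_upwards [Lp.coeFn_add p q, hpg, hqk] with x h1 h2 h3
  rw [h1, Pi.add_apply, h2, h3, Pi.add_apply]

theorem convex_admissibleTraces (h : ℝ) : Convex ℝ (admissibleTraces h) := by
  refine convex_iff_forall_pos.2 fun p hp q hq a b ha hb _ => ?_
  exact add_mem_admissibleTraces (smul_mem_admissibleTraces ha hp) (smul_mem_admissibleTraces hb hq)

theorem smul_mem_closure_admissibleTraces {h a : ℝ} (ha : 0 < a) {p : L2Unit}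
    (hp : p ∈ closure (admissibleTraces h)) : a • p ∈ closure (admissibleTraces h) :=
  map_mem_closure (continuous_const_smul a) hp fun _ hz => smul_mem_admissibleTraces ha hz

/-- Locally uniform convergence on the half-plane is uniform on `[0, 1]`, so it implies
convergence in `L²(0, 1)`. -/
theorem IsInClosure.toLp_mem {h : ℝ} (hh : 0 < h) {f : ℂ → ℂ} (hf : IsInClosure h f) :
    (hf.memLp hh).toLp ∈ closure (admissibleTraces h) := by
  obtain ⟨g, hg, hlim⟩ := hf.2
  have hgm := fun n => (hg n).isInClosure.memLp hh
  have hmem : ∀ n, (hgm n).toLp ∈ admissibleTraces h := fun n => ⟨g n, hg n, (hgm n).coeFn_toLp⟩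
  refine mem_closure_of_tendsto (b := atTop) (f := fun n => (hgm n).toLp) ?_
    (Eventually.of_forall hmem)
  rw [tendstoLocallyUniformlyOn_iff_forall_isCompact (isOpen_halfPlane h)] at hlim
  have hK := hlim ((fun x : ℝ => (x : ℂ)) '' Set.Icc 0 1)
    (by rintro _ ⟨x, _, rfl⟩; exact ofReal_mem_halfPlane hh x)
    (isCompact_Icc.image Complex.continuous_ofReal)
  rw [Metric.tendstoUniformlyOn_iff] at hK
  rw [Metric.tendsto_nhds]
  intro ε hε
  filter_upwards [hK (ε / 2) (half_pos hε)] with n hn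
  rw [dist_eq_norm, ← MemLp.toLp_sub]
  refine lt_of_le_of_lt ?_ (half_lt_self hε)
  have h1 : ∀ᵐ x ∂unitMeasure, ‖(((hgm n).sub (hf.memLp hh)).toLp _ : L2Unit) x‖ ≤ ε / 2 := by
    filter_upwards [((hgm n).sub (hf.memLp hh)).coeFn_toLp, ae_unitMeasure_mem] with x hx hx'
    rw [hx, Pi.sub_apply, ← dist_eq_norm, dist_comm]
    exact (hn _ ⟨x, Set.Ioo_subset_Icc_self hx', rfl⟩).le
  have h2 := Lp.norm_le_of_ae_bound (half_pos hε).le h1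
  simpa [Measure.real, measureUnivNNReal] using h2

/-- Minimality over `S_h` is minimality over the closed cone, since `S_h` contains `K_h` and restricts
into the closure of its restrictions. -/
theorem isMinimizer_iff {h : ℝ} (hh : 0 < h) {f : ℂ → ℂ} (hf : IsInClosure h f) {fexp : ℝ → ℂ}
    (hfexp : MemLp fexp 2 unitMeasure) :
    IsMinimizer h fexp f ↔ ∀ z ∈ closure (admissibleTraces h),
      ‖(hf.memLp hh).toLp - hfexp.toLp‖ ≤ ‖z - hfexp.toLp‖ := by
  constructor
  · rintro ⟨-, hmin⟩ z hz
    refine closure_minimal (t := {z | ‖(hf.memLp hh).toLp - hfexp.toLp‖ ≤ ‖z - hfexp.toLp‖}) ?_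
      (isClosed_le continuous_const (by fun_prop)) hz
    rintro z ⟨g, hg, hzg⟩
    have h1 := hmin g hg.isInClosure
    rw [l2Dist_eq hh hf hfexp, l2Dist_eq hh hg.isInClosure hfexp,
      ENNReal.ofReal_le_ofReal_iff (norm_nonneg _)] at h1
    have h2 : z = (hg.isInClosure.memLp hh).toLp :=
      Lp.ext (hzg.trans (hg.isInClosure.memLp hh).coeFn_toLp.symm)
    rw [Set.mem_ofPred_eq, h2]
    exact h1
  · intro hmin
    refine ⟨hf, fun g hg => ?_⟩
    rw [l2Dist_eq hh hf hfexp, l2Dist_eq hh hg hfexp]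
    exact ENNReal.ofReal_le_ofReal (hmin _ (hg.toLp_mem hh))

/-- A continuous function on `[0, 1]` is determined by its class in `L²(0, 1)`, and an analytic
function on the half-plane by its values on `(0, 1)`. -/
theorem eqOn_halfPlane_of_toLp_eq {h : ℝ} (hh : 0 < h) {f g : ℂ → ℂ} (hf : IsInClosure h f)
    (hg : IsInClosure h g) (hfg : (hf.memLp hh).toLp = (hg.memLp hh).toLp) :
    Set.EqOn f g (halfPlane h) := by
  have h1 : (fun x : ℝ => f (x : ℂ)) =ᵐ[unitMeasure] fun x : ℝ => g (x : ℂ) :=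
    (MemLp.toLp_eq_toLp_iff _ _).1 hfg
  have h2 : Set.EqOn (fun x : ℝ => f (x : ℂ)) (fun x : ℝ => g (x : ℂ)) (Set.Ioo 0 1) :=
    Measure.eqOn_open_of_ae_eq h1 isOpen_Ioo
      (continuousOn_comp_ofReal hh hf.1.continuousOn).continuousOn
      (continuousOn_comp_ofReal hh hg.1.continuousOn).continuousOn
  have hfa := hf.1.analyticOnNhd (isOpen_halfPlane h)
  have hga := hg.1.analyticOnNhd (isOpen_halfPlane h)
  refine hfa.eqOn_of_preconnected_of_frequently_eq hga (convex_halfPlane h).isPreconnected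
    (ofReal_mem_halfPlane hh (1 / 2)) ?_
  have h3 : Tendsto (fun x : ℝ => (x : ℂ)) (𝓝[>] (1 / 2)) (𝓝[≠] ((1 / 2 : ℝ) : ℂ)) := by
    refine tendsto_nhdsWithin_of_tendsto_nhds_of_eventually_within _
      ((Complex.continuous_ofReal.tendsto _).mono_left nhdsWithin_le_nhds) ?_
    filter_upwards [self_mem_nhdsWithin] with x hx
    exact fun hx' => (ne_of_gt (Set.mem_Ioi.1 hx)) (Complex.ofReal_injective hx')
  refine h3.frequently (Eventually.frequently ?_)
  filter_upwards [Ioo_mem_nhdsGT (show (1 / 2 : ℝ) < 1 by norm_num)] with x hx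
  exact h2 ⟨by linarith [hx.1], hx.2⟩

/-! ### Cauchy integrals in the half-plane -/

/-- A decay estimate near infinity, made uniform by compactness. -/
theorem exists_bound_inv_one_add_sq {φ : ℝ → ℂ} (hφ : Continuous φ) {C R : ℝ}
    (hb : ∀ x : ℝ, R ≤ |x| → ‖φ x‖ ≤ C / x ^ 2) :
    ∃ D, 0 ≤ D ∧ ∀ x, ‖φ x‖ ≤ D * (1 + x ^ 2)⁻¹ := by
  set T := max R 1
  obtain ⟨M, hM⟩ := (isCompact_Icc (a := -T) (b := T)).bddAbove_image
    (f := fun x => ‖φ x‖ * (1 + x ^ 2)) (by fun_prop)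
  refine ⟨max M (2 * |C|), le_max_of_le_right (by positivity), fun x => ?_⟩
  rw [← div_eq_mul_inv, le_div_iff₀ (by positivity)]
  rcases le_total |x| T with hx | hx
  · exact le_max_of_le_left (hM ⟨x, abs_le.1 hx, rfl⟩)
  · have hx1 : 1 ≤ |x| := (le_max_right _ _).trans hx
    have hx2 : 1 ≤ x ^ 2 := by rw [← sq_abs]; nlinarith
    refine le_max_of_le_right ?_
    have h1 := hb x ((le_max_left _ _).trans hx)
    calc ‖φ x‖ * (1 + x ^ 2) ≤ |C| / x ^ 2 * (2 * x ^ 2) := by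
          gcongr
          · exact h1.trans (by gcongr; exact le_abs_self C)
          · linarith
      _ = 2 * |C| := by
          have : x ^ 2 ≠ 0 := by positivity
          rw [div_mul_eq_mul_div, mul_left_comm, ← mul_assoc, mul_div_assoc, div_self this, mul_one]

theorem integrable_of_decay {φ : ℝ → ℂ} (hφ : Continuous φ) {C R : ℝ}
    (hb : ∀ x : ℝ, R ≤ |x| → ‖φ x‖ ≤ C / x ^ 2) : Integrable φ := by
  obtain ⟨D, -, hD⟩ := exists_bound_inv_one_add_sq hφ hb
  exact (integrable_inv_one_add_sq.const_mul D).mono' hφ.aestronglyMeasurable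
    (Eventually.of_forall hD)

/-- `G` is analytic on a neighbourhood of the closed upper half-plane and `O(z⁻²)` at infinity
there. -/
structure HasQuadraticDecay (G : ℂ → ℂ) : Prop where
  analytic : ∃ ε > 0, DifferentiableOn ℂ G {z | -ε < z.im}
  decay : ∃ C R : ℝ, ∀ z : ℂ, 0 ≤ z.im → R ≤ ‖z‖ → ‖G z‖ ≤ C / ‖z‖ ^ 2

theorem HasQuadraticDecay.continuous {G : ℂ → ℂ} (hG : HasQuadraticDecay G) :
    Continuous fun x : ℝ => G x := by
  obtain ⟨ε, hε, h⟩ := hG.analytic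
  exact h.continuousOn.comp_continuous Complex.continuous_ofReal fun x => by simpa using hε

theorem HasQuadraticDecay.integrable {G : ℂ → ℂ} (hG : HasQuadraticDecay G) :
    Integrable fun x : ℝ => G x := by
  obtain ⟨C, R, h⟩ := hG.decay
  refine integrable_of_decay hG.continuous (C := C) (R := R) fun x hx => ?_
  simpa using h x (by simp) (by simpa using hx)

/-- Cauchy's theorem on the rectangles with corners `-T` and `T + i T`. -/
theorem HasQuadraticDecay.integral_eq_zero {G : ℂ → ℂ} (hG : HasQuadraticDecay G) :
    ∫ x : ℝ, G x = 0 := by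
  obtain ⟨C, R, hdec⟩ := hG.decay
  obtain ⟨ε, hε, hdiff⟩ := hG.analytic
  have hlim := intervalIntegral_tendsto_integral hG.integrable tendsto_neg_atTop_atBot tendsto_id
  refine tendsto_nhds_unique hlim (squeeze_zero_norm' (a := fun T : ℝ => 4 * |C| / T) ?_ ?_)
  · filter_upwards [eventually_ge_atTop (max R 1)] with T hT
    have hT1 : 1 ≤ T := (le_max_right _ _).trans hT
    have hT0 : 0 < T := by linarith
    have hb : ∀ z : ℂ, 0 ≤ z.im → T ≤ ‖z‖ → ‖G z‖ ≤ |C| / T ^ 2 := fun z hz hz' =>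
      (hdec z hz ((le_max_left _ _).trans (hT.trans hz'))).trans (by
        have : C ≤ |C| := le_abs_self C
        gcongr)
    have hrect := Complex.integral_boundary_rect_eq_zero_of_differentiableOn G
      ((-T : ℝ) : ℂ) ((T : ℝ) + (T : ℝ) * Complex.I) (hdiff.mono fun z hz => by
        rw [Complex.mem_reProdIm] at hz
        have h1 := hz.2
        simp [Set.uIcc_of_le hT0.le] at h1
        simp only [Set.mem_ofPred_eq]; linarith)
    simp only [Complex.ofReal_re, Complex.ofReal_im, Complex.add_re, Complex.add_im, Complex.mul_re,
      Complex.mul_im, Complex.I_re, Complex.I_im, mul_zero, mul_one, sub_zero, add_zero,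
      zero_add, Complex.ofReal_zero, zero_mul] at hrect
    have htop : ‖∫ x in (-T)..T, G (x + T * Complex.I)‖ ≤ |C| / T ^ 2 * |T - -T| := by
      refine intervalIntegral.norm_integral_le_of_norm_le_const fun x _ => hb _ (by simp [hT0.le]) ?_
      have := Complex.abs_im_le_norm ((x : ℂ) + T * Complex.I)
      simpa [abs_of_pos hT0] using this
    have hside : ∀ a : ℝ, |a| = T →
        ‖∫ y in (0 : ℝ)..T, G (a + y * Complex.I)‖ ≤ |C| / T ^ 2 * |T - 0| := by
      intro a ha
      refine intervalIntegral.norm_integral_le_of_norm_le_const fun y hy => hb _ ?_ ?_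
      · rw [Set.uIoc_of_le hT0.le] at hy
        simpa using hy.1.le
      · have := Complex.abs_re_le_norm ((a : ℂ) + y * Complex.I)
        simpa [ha] using this
    have hr := hside T (abs_of_pos hT0)
    have hl := hside (-T) (by rw [abs_neg, abs_of_pos hT0])
    have heq : ∫ x in (-T)..T, G x = (∫ x in (-T)..T, G (x + T * Complex.I))
        - Complex.I • (∫ y in (0 : ℝ)..T, G (T + y * Complex.I))
        + Complex.I • ∫ y in (0 : ℝ)..T, G ((-T : ℝ) + y * Complex.I) := by
      linear_combination hrect
    rw [id, heq]
    refine (norm_add_le _ _).trans ((add_le_add_left (norm_sub_le _ _) _).trans ?_)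
    rw [norm_smul, norm_smul, Complex.norm_I, one_mul, one_mul]
    refine (add_le_add (add_le_add htop hr) hl).trans (le_of_eq ?_)
    rw [sub_neg_eq_add, sub_zero, abs_of_pos hT0, abs_of_pos (by linarith : 0 < T + T)]
    field_simp; ring
  · exact tendsto_const_nhds.div_atTop tendsto_id

theorem ofReal_sub_ne_zero {ζ : ℂ} (hζ : ζ.im ≠ 0) (s : ℝ) : (s : ℂ) - ζ ≠ 0 := fun h => by
  have := congrArg Complex.im h
  simp at this
  exact hζ this

theorem im_le_norm_sub_conj {ζ z : ℂ} (hz : 0 ≤ z.im) :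
    ζ.im ≤ ‖z - (starRingEnd ℂ) ζ‖ := by
  have := (le_abs_self _).trans (Complex.abs_im_le_norm (z - (starRingEnd ℂ) ζ))
  simp at this
  linarith

theorem HasQuadraticDecay.div_sub_conj {F : ℂ → ℂ} (hF : HasQuadraticDecay F) {ζ : ℂ}
    (hζ : 0 < ζ.im) : HasQuadraticDecay fun z => F z / (z - (starRingEnd ℂ) ζ) where
  analytic := by
    obtain ⟨ε, hε, h⟩ := hF.analytic
    refine ⟨min ε ζ.im, lt_min hε hζ, DifferentiableOn.div (h.mono fun z hz => ?_) (by fun_prop) ?_⟩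
    · have : -min ε ζ.im < z.im := hz
      have := min_le_left ε ζ.im
      simp only [Set.mem_ofPred_eq]; linarith
    · intro z hz h0
      have h1 : -min ε ζ.im < z.im := hz
      have h2 := min_le_right ε ζ.im
      have h3 := congrArg Complex.im h0
      simp at h3
      linarith
  decay := by
    obtain ⟨C, R, h⟩ := hF.decay
    refine ⟨C / ζ.im, R, fun z hz hR => ?_⟩
    rw [norm_div, div_right_comm]
    have h1 := h z hz hR
    have h2 := im_le_norm_sub_conj (ζ := ζ) hz
    have h3 : 0 ≤ C / ‖z‖ ^ 2 := (norm_nonneg _).trans h1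
    gcongr

/-- The total mass of the Poisson kernel. -/
theorem integral_poisson {ζ : ℂ} (hζ : 0 < ζ.im) :
    ∫ s : ℝ, 1 / (((s : ℂ) - (starRingEnd ℂ) ζ) * ((s : ℂ) - ζ)) = (Real.pi / ζ.im : ℝ) := by
  have h1 : ∀ s : ℝ, 1 / (((s : ℂ) - (starRingEnd ℂ) ζ) * ((s : ℂ) - ζ))
      = ((1 / ζ.im ^ 2 * (1 + ((s - ζ.re) / ζ.im) ^ 2)⁻¹ : ℝ) : ℂ) := by
    intro s
    have h2 : ((s : ℂ) - (starRingEnd ℂ) ζ) * ((s : ℂ) - ζ) = (((s - ζ.re) ^ 2 + ζ.im ^ 2 : ℝ) : ℂ) := by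
      have : (s : ℂ) - (starRingEnd ℂ) ζ = (starRingEnd ℂ) ((s : ℂ) - ζ) := by simp
      rw [this, ← Complex.normSq_eq_conj_mul_self, Complex.normSq_apply]
      simp; ring
    rw [h2, ← Complex.ofReal_one, ← Complex.ofReal_div]
    congr 1
    have : (s - ζ.re) ^ 2 + ζ.im ^ 2 ≠ 0 := by positivity
    field_simp
    ring
  simp_rw [h1]
  rw [integral_complex_ofReal]
  congr 1
  rw [integral_const_mul, integral_sub_right_eq_self (fun s => (1 + (s / ζ.im) ^ 2)⁻¹) ζ.re,
    Measure.integral_comp_div (fun s => (1 + s ^ 2)⁻¹), integral_univ_inv_one_add_sq,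
    abs_of_pos hζ, smul_eq_mul]
  field_simp

/-- Cauchy's formula in the half-plane. The function `F(z) - F(ζ) (ζ - ζ̄) / (z - ζ̄)` vanishes
at `ζ`, and dividing it by `z - ζ` leaves a function with integral zero. -/
theorem HasQuadraticDecay.integral_div_sub {F : ℂ → ℂ} (hF : HasQuadraticDecay F) {ζ : ℂ}
    (hζ : 0 < ζ.im) : ∫ s : ℝ, F s / ((s : ℂ) - ζ) = 2 * Real.pi * Complex.I * F ζ := by
  set ζ' := (starRingEnd ℂ) ζ with hζ'
  set P : ℂ → ℂ := fun z => F z - F ζ * (ζ - ζ') / (z - ζ') with hP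
  have hζζ' : ζ - ζ' ≠ 0 := by
    intro h
    have := congrArg Complex.im h
    simp [hζ'] at this
    linarith
  have hPζ : P ζ = 0 := by simp only [hP]; field_simp; ring
  have hval : ∀ z, z ≠ ζ → dslope P ζ z = P z / (z - ζ) := by
    intro z hz
    rw [dslope_of_ne _ hz, slope_def_field, hPζ, sub_zero]
  have hG : HasQuadraticDecay (dslope P ζ) := by
    constructor
    · obtain ⟨ε, hε, h⟩ := hF.analytic
      refine ⟨min ε ζ.im, lt_min hε hζ, ?_⟩
      have hopen : IsOpen {z : ℂ | -min ε ζ.im < z.im} :=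
        isOpen_lt continuous_const Complex.continuous_im
      have hmem : ζ ∈ {z : ℂ | -min ε ζ.im < z.im} := by
        have := lt_min hε hζ
        simp only [Set.mem_ofPred_eq]; linarith
      rw [Complex.differentiableOn_dslope (hopen.mem_nhds hmem)]
      refine DifferentiableOn.sub (h.mono fun z hz => ?_)
        (DifferentiableOn.div (by fun_prop) (by fun_prop) ?_)
      · have : -min ε ζ.im < z.im := hz
        have := min_le_left ε ζ.im
        simp only [Set.mem_ofPred_eq]; linarith
      · intro z hz h0
        have h1 : -min ε ζ.im < z.im := hz
        have h2 := min_le_right ε ζ.im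
        have h3 := congrArg Complex.im h0
        simp [hζ'] at h3
        linarith
    · obtain ⟨C, R, h⟩ := hF.decay
      refine ⟨2 * (|C| + 2 * ‖F ζ * (ζ - ζ')‖), max R (2 * ‖ζ‖ + 1), fun z hz hR => ?_⟩
      have h1 : R ≤ ‖z‖ := (le_max_left _ _).trans hR
      have h2 : 2 * ‖ζ‖ + 1 ≤ ‖z‖ := (le_max_right _ _).trans hR
      have hζ0 := norm_nonneg ζ
      have hz1 : 1 ≤ ‖z‖ := by linarith
      have hz0 : 0 < ‖z‖ := by linarith
      have hzζ : z ≠ ζ := by rintro rfl; linarith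
      have h3 : ‖z‖ / 2 ≤ ‖z - ζ‖ := by
        have := norm_sub_norm_le z ζ
        linarith
      have h4 : ‖z‖ / 2 ≤ ‖z - ζ'‖ := by
        have := norm_sub_norm_le z ζ'
        rw [hζ', RCLike.norm_conj] at this
        linarith
      rw [hval z hzζ, norm_div]
      have h5 : ‖P z‖ ≤ (|C| + 2 * ‖F ζ * (ζ - ζ')‖) / ‖z‖ := by
        calc ‖P z‖ ≤ ‖F z‖ + ‖F ζ * (ζ - ζ')‖ / ‖z - ζ'‖ := by
              rw [← norm_div]; exact norm_sub_le _ _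
          _ ≤ |C| / ‖z‖ ^ 1 + ‖F ζ * (ζ - ζ')‖ / (‖z‖ / 2) := by
              refine add_le_add ((h z hz h1).trans ?_) (by gcongr)
              exact div_le_div₀ (abs_nonneg _) (le_abs_self C) (by positivity)
                (pow_le_pow_right₀ hz1 (by norm_num))
          _ = _ := by field_simp
      calc ‖P z‖ / ‖z - ζ‖ ≤ ((|C| + 2 * ‖F ζ * (ζ - ζ')‖) / ‖z‖) / (‖z‖ / 2) := by gcongr
        _ = _ := by field_simp
  have h0 := hG.integral_eq_zero
  have hQ := hF.div_sub_conj hζ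
  have hne : ∀ s : ℝ, (s : ℂ) - ζ ≠ 0 := ofReal_sub_ne_zero hζ.ne'
  have hne' : ∀ s : ℝ, (s : ℂ) - ζ' ≠ 0 := ofReal_sub_ne_zero (by simp [hζ', hζ.ne'])
  have hpi : Integrable fun s : ℝ => 1 / (((s : ℂ) - ζ') * ((s : ℂ) - ζ)) := by
    by_contra hcon
    have h1 := integral_poisson hζ
    rw [integral_undef hcon] at h1
    have h2 : (Real.pi / ζ.im : ℝ) = 0 := by exact_mod_cast h1.symm
    have := Real.pi_pos
    exact absurd h2 (by positivity)
  have hsplit : ∀ s : ℝ, F s / ((s : ℂ) - ζ) = dslope P ζ s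
      + F ζ * (ζ - ζ') * (1 / (((s : ℂ) - ζ') * ((s : ℂ) - ζ))) := by
    intro s
    rw [hval s (sub_ne_zero.1 (hne s))]
    have := hne s
    have := hne' s
    simp only [hP]
    field_simp
    ring
  simp_rw [hsplit]
  rw [integral_add hG.integrable (hpi.const_mul _), h0, integral_const_mul, integral_poisson hζ]
  have h2 : ζ - ζ' = 2 * ζ.im * Complex.I := by
    rw [hζ', Complex.sub_conj]; push_cast; ring
  rw [h2]
  have : (ζ.im : ℂ) ≠ 0 := by exact_mod_cast hζ.ne'
  push_cast
  field_simp
  ring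

theorem HasQuadraticDecay.integrable_div_sub {F : ℂ → ℂ} (hF : HasQuadraticDecay F) {ζ : ℂ}
    (hζ : ζ.im ≠ 0) : Integrable fun s : ℝ => F s / ((s : ℂ) - ζ) := by
  have hc : Continuous fun s : ℝ => 1 / ((s : ℂ) - ζ) :=
    continuous_const.div (by fun_prop) (ofReal_sub_ne_zero hζ)
  have h := hF.integrable.mul_bdd (c := 1 / |ζ.im|) hc.aestronglyMeasurable
    (Eventually.of_forall fun s => by
      rw [norm_div, norm_one]
      have := Complex.abs_im_le_norm ((s : ℂ) - ζ)
      simp at this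
      have h0 : 0 < |ζ.im| := abs_pos.2 hζ
      gcongr)
  simpa [div_eq_mul_inv] using h

/-- A function on the half-plane is recovered from the imaginary part of its boundary values. -/
theorem HasQuadraticDecay.eq_integral_im {F : ℂ → ℂ} (hF : HasQuadraticDecay F) {ζ : ℂ}
    (hζ : 0 < ζ.im) : Real.pi * F ζ = ∫ s : ℝ, ((F s).im : ℂ) / ((s : ℂ) - ζ) := by
  set ζ' := (starRingEnd ℂ) ζ with hζ'
  have h1 := hF.integral_div_sub hζ
  have h2 := (hF.div_sub_conj hζ).integral_eq_zero
  have h3 : ∫ s : ℝ, (starRingEnd ℂ) (F s / ((s : ℂ) - ζ')) = 0 := by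
    rw [integral_conj]; simpa using h2
  have hi1 := hF.integrable_div_sub hζ.ne'
  have hi2 := hF.integrable_div_sub (ζ := ζ') (by simp [hζ', hζ.ne'])
  have hi3 : Integrable fun s : ℝ => (starRingEnd ℂ) (F s / ((s : ℂ) - ζ')) :=
    (LinearIsometryEquiv.integrable_comp_iff Complex.conjLIE).2 hi2
  have h4 : ∀ s : ℝ, ((F s).im : ℂ) / ((s : ℂ) - ζ)
      = 1 / (2 * Complex.I) * (F s / ((s : ℂ) - ζ) - (starRingEnd ℂ) (F s / ((s : ℂ) - ζ'))) := by
    intro s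
    have h5 : (starRingEnd ℂ) (F s / ((s : ℂ) - ζ')) = (starRingEnd ℂ) (F s) / ((s : ℂ) - ζ) := by
      simp [hζ']
    rw [h5, ← sub_div, Complex.sub_conj]
    have := Complex.I_ne_zero
    push_cast
    field_simp
  simp_rw [h4]
  rw [integral_const_mul, integral_sub hi1 hi3, h1, h3]
  have := Complex.I_ne_zero
  field_simp
  ring

/-- The symmetric form of the representation: only the values `s²` enter the kernel. -/
theorem HasQuadraticDecay.eq_integral_stieltjes {F : ℂ → ℂ} (hF : HasQuadraticDecay F)
    (hodd : ∀ s : ℝ, (F ((-s : ℝ) : ℂ)).im = -(F s).im) {ζ : ℂ} (hζ : 0 < ζ.im) :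
    Real.pi * F ζ = ∫ s : ℝ, ((s * (F s).im : ℝ) : ℂ) / ((s : ℂ) ^ 2 - ζ ^ 2) := by
  have hint : ∀ ζ : ℂ, ζ.im ≠ 0 → Integrable fun s : ℝ => ((F s).im : ℂ) / ((s : ℂ) - ζ) := by
    intro ζ hζ
    refine (hF.integrable_div_sub hζ).mono ?_ (Eventually.of_forall fun s => ?_)
    · exact (Continuous.div (Complex.continuous_ofReal.comp
        (Complex.continuous_im.comp hF.continuous)) (by fun_prop)
        (ofReal_sub_ne_zero hζ)).aestronglyMeasurable
    · rw [norm_div, norm_div, Complex.norm_real]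
      have := Complex.abs_im_le_norm (F s)
      rw [Real.norm_eq_abs]
      gcongr
  have h1 := hF.eq_integral_im hζ
  have h2 : Real.pi * F ζ = ∫ s : ℝ, ((F s).im : ℂ) / ((s : ℂ) - -ζ) := by
    rw [h1, ← integral_neg_eq_self]
    refine integral_congr_ae (Eventually.of_forall fun s => ?_)
    simp only
    rw [hodd]
    push_cast
    rw [sub_neg_eq_add, ← neg_div_neg_eq]
    congr 1 <;> ring
  have h3 : (∫ s : ℝ, ((s * (F s).im : ℝ) : ℂ) / ((s : ℂ) ^ 2 - ζ ^ 2))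
      = ∫ s : ℝ, (1 / 2 : ℂ) * (((F s).im : ℂ) / ((s : ℂ) - ζ) + ((F s).im : ℂ) / ((s : ℂ) - -ζ)) := by
    refine integral_congr_ae (Eventually.of_forall fun s => ?_)
    have h4 := ofReal_sub_ne_zero hζ.ne' s
    have h5 := ofReal_sub_ne_zero (ζ := -ζ) (by simp [hζ.ne']) s
    have h6 : (s : ℂ) ^ 2 - ζ ^ 2 = ((s : ℂ) - ζ) * ((s : ℂ) - -ζ) := by ring
    simp only
    rw [h6]
    push_cast
    field_simp
    ring
  rw [h3, integral_const_mul, integral_add (hint ζ hζ.ne') (hint (-ζ) (by simp [hζ.ne'])), ← h1,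
    ← h2]
  ring

/-! ### Admissible functions as superpositions of kernels -/

theorem mem_halfPlane_shift {h ε : ℝ} {z : ℂ} (hz : -ε < z.im) :
    z - Complex.I * h + Complex.I * ε ∈ halfPlane h := by
  simp [halfPlane]; linarith

theorem IsAdmissible.exists_decay {h : ℝ} {g : ℂ → ℂ} (hg : IsAdmissible h g) :
    ∃ C R : ℝ, 0 ≤ C ∧ ∀ ω ∈ halfPlane h, R ≤ ‖ω‖ → ‖g ω‖ ≤ C / ‖ω‖ ^ 2 := by
  obtain ⟨A, hA, hO⟩ := hg.plasma
  obtain ⟨c, hc⟩ := hO.bound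
  rw [eventually_inf_principal, ← comap_norm_atTop, eventually_comap] at hc
  obtain ⟨R, hR⟩ := eventually_atTop.1 hc
  refine ⟨A + |c|, max R 1, by positivity, fun ω hω hωR => ?_⟩
  have h1 := hR ‖ω‖ ((le_max_left _ _).trans hωR) ω rfl hω
  have h2 : 1 ≤ ‖ω‖ := (le_max_right _ _).trans hωR
  have h0 : 0 < ‖ω‖ := by linarith
  rw [norm_div, norm_one, norm_pow] at h1
  calc ‖g ω‖ = ‖(g ω - -(A : ℂ) / ω ^ 2) + -(A : ℂ) / ω ^ 2‖ := by rw [sub_add_cancel]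
    _ ≤ |c| * (1 / ‖ω‖ ^ 2) + A / ‖ω‖ ^ 2 := by
        refine (norm_add_le _ _).trans (add_le_add (h1.trans ?_) (le_of_eq ?_))
        · exact mul_le_mul (le_abs_self c) (one_div_le_one_div_of_le (by positivity)
            (pow_le_pow_right₀ h2 (by norm_num))) (by positivity) (abs_nonneg c)
        · simp [abs_of_pos hA]
    _ = _ := by ring

/-- The shift by `ε` moves the boundary of the half-plane off the real line in the variable
`z = ω + i h`. -/
theorem IsAdmissible.hasQuadraticDecay {h : ℝ} {g : ℂ → ℂ} (hg : IsAdmissible h g)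
    {ε : ℝ} (hε : 0 < ε) :
    HasQuadraticDecay fun z => g (z - Complex.I * h + Complex.I * ε) where
  analytic := ⟨ε, hε, hg.analytic.comp (t := halfPlane h) (by fun_prop)
    fun _ hz => mem_halfPlane_shift hz⟩
  decay := by
    obtain ⟨C, R, hC, hdec⟩ := hg.exists_decay
    set k := |h| + |ε| with hk
    refine ⟨4 * C, max (R + k) (2 * k + 1), fun z hz hR => ?_⟩
    have h1 : R + k ≤ ‖z‖ := (le_max_left _ _).trans hR
    have h2 : 2 * k + 1 ≤ ‖z‖ := (le_max_right _ _).trans hR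
    have hk0 : 0 ≤ k := by positivity
    set w := z - Complex.I * h + Complex.I * ε with hw
    have h3 : ‖z‖ - k ≤ ‖w‖ := by
      have h4 : ‖z‖ ≤ ‖w‖ + (‖Complex.I * (h : ℂ)‖ + ‖Complex.I * (ε : ℂ)‖) := by
        calc ‖z‖ = ‖w + (Complex.I * h - Complex.I * ε)‖ := by rw [hw]; congr 1; ring
          _ ≤ _ := (norm_add_le _ _).trans (by gcongr; exact norm_sub_le _ _)
      simp only [norm_mul, Complex.norm_I, one_mul, Complex.norm_real, Real.norm_eq_abs] at h4
      linarith
    refine (hdec w (mem_halfPlane_shift (by linarith)) (by linarith)).trans ?_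
    have h5 : ‖z‖ / 2 ≤ ‖w‖ := by linarith
    have h6 : 0 < ‖z‖ := by linarith
    calc C / ‖w‖ ^ 2 ≤ C / (‖z‖ / 2) ^ 2 := by gcongr
      _ = _ := by field_simp; norm_num

theorem continuous_stieltjes_denom (h : ℝ) : Continuous fun q : ℝ × ℝ =>
    ((q.2 : ℂ) ^ 2 - ((q.1 : ℂ) - Complex.I * h) ^ 2) := by fun_prop

/-- Positivity of the pairing with all kernels gives positivity of the pairing with a shifted
admissible function, which is a positive superposition of kernels. -/
theorem IsAdmissible.re_integral_shift_nonneg {h : ℝ} (hh : 0 < h) {g : ℂ → ℂ}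
    (hg : IsAdmissible h g) {r : ℝ → ℂ} (hr : Integrable r unitMeasure)
    (hpos : ∀ s : ℝ, 0 ≤ s →
      0 ≤ (∫ x, r x / ((s : ℂ) - ((x : ℂ) - Complex.I * h) ^ 2) ∂unitMeasure).re)
    {ε : ℝ} (hε : 0 < ε) :
    0 ≤ (∫ x, r x * (starRingEnd ℂ) (g (x + Complex.I * ε)) ∂unitMeasure).re := by
  set F : ℂ → ℂ := fun z => g (z - Complex.I * h + Complex.I * ε) with hF
  have hdec : HasQuadraticDecay F := hg.hasQuadraticDecay hε
  have hmem : ∀ s : ℝ, (s : ℂ) - Complex.I * h + Complex.I * ε ∈ halfPlane h := fun s =>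
    mem_halfPlane_shift (by simpa using hε)
  have hodd : ∀ s : ℝ, (F ((-s : ℝ) : ℂ)).im = -(F s).im := by
    intro s
    rw [← Complex.conj_im]
    simp only [hF]
    rw [hg.symmetry _ (hmem s)]
    congr 2
    simp
    ring
  set u : ℝ → ℝ := fun s => s * (F s).im with hu
  have hu0 : ∀ s, 0 ≤ u s := by
    have hp : ∀ s, 0 < s → 0 ≤ u s := fun s hs =>
      mul_nonneg hs.le (hg.passivity _ (hmem s) (by simpa using hs)).le
    intro s
    rcases lt_trichotomy s 0 with hs | rfl | hs
    · have := hp (-s) (by linarith)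
      simp only [hu] at this ⊢
      rw [hodd] at this
      linarith
    · simp [hu]
    · exact hp s hs
  have hrep : ∀ x : ℝ, (Real.pi : ℂ) * (starRingEnd ℂ) (g (x + Complex.I * ε))
      = ∫ s : ℝ, (u s : ℂ) / ((s : ℂ) ^ 2 - ((x : ℂ) - Complex.I * h) ^ 2) := by
    intro x
    have h1 := hdec.eq_integral_stieltjes hodd (ζ := x + Complex.I * h) (by simpa using hh)
    have h2 : F (x + Complex.I * h) = g (x + Complex.I * ε) := by
      simp only [hF]; congr 1; ring
    rw [h2] at h1
    have h3 := congrArg (starRingEnd ℂ) h1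
    rw [map_mul, Complex.conj_ofReal, ← integral_conj] at h3
    rw [h3]
    refine integral_congr_ae (Eventually.of_forall fun s => ?_)
    simp [hu, sub_eq_add_neg]
  -- Fubini: `r(x) u(s) / (s² - (x - i h)²)` is integrable on the product, because the kernel is
  -- bounded by a multiple of `1 / (1 + s²)`, and `u(s) / (1 + s²)` decays like `s⁻³`
  have hden : ∀ x ∈ Set.Ioo (0 : ℝ) 1, ∀ s : ℝ,
      1 + s ^ 2 ≤ kernelBound h * ‖(s : ℂ) ^ 2 - ((x : ℂ) - Complex.I * h) ^ 2‖ := by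
    intro x hx s
    have := one_add_le_kernelBound_mul hh (z := (x : ℂ) - Complex.I * h) (s := s ^ 2)
      (by simpa [abs_of_pos hx.1] using hx.2.le) (by simp [abs_of_pos hh]) (sq_nonneg s)
    simpa using this
  have huc : Continuous u := continuous_id.mul (Complex.continuous_im.comp hdec.continuous)
  have hui : Integrable fun s : ℝ => (u s : ℂ) / (1 + s ^ 2 : ℝ) := by
    obtain ⟨C, R, hCR⟩ := hdec.decay
    refine integrable_of_decay (C := |C|) (R := max R 1) ?_ fun s hs => ?_
    · exact (Complex.continuous_ofReal.comp huc).div (by fun_prop) fun s => by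
        exact_mod_cast (by positivity : (1 + s ^ 2 : ℝ) ≠ 0)
    · have h1 : R ≤ |s| := (le_max_left _ _).trans hs
      have h2 : 1 ≤ |s| := (le_max_right _ _).trans hs
      have h3 := hCR s (by simp) (by simpa using h1)
      rw [Complex.norm_real, Real.norm_eq_abs, sq_abs] at h3
      have h4 : 1 ≤ s ^ 2 := by rw [← sq_abs]; nlinarith
      rw [norm_div, Complex.norm_real, Complex.norm_real, Real.norm_eq_abs, Real.norm_eq_abs,
        abs_of_pos (by positivity : 0 < 1 + s ^ 2), abs_mul]
      have h5 : |s| ≤ 1 + s ^ 2 := by rw [← sq_abs]; nlinarith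
      rw [div_le_iff₀ (by positivity)]
      calc |s| * |(F s).im| ≤ (1 + s ^ 2) * (|C| / s ^ 2) := by
            gcongr
            exact (Complex.abs_im_le_norm _).trans (h3.trans (by gcongr; exact le_abs_self C))
        _ = _ := by ring
  have hprod : Integrable (fun q : ℝ × ℝ => r q.1 * ((u q.2 : ℂ) /
      ((q.2 : ℂ) ^ 2 - ((q.1 : ℂ) - Complex.I * h) ^ 2))) (unitMeasure.prod volume) := by
    have h1 := (hr.mul_prod hui).mul_bdd (c := kernelBound h)
      (g := fun q : ℝ × ℝ => ((1 + q.2 ^ 2 : ℝ) : ℂ) /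
        ((q.2 : ℂ) ^ 2 - ((q.1 : ℂ) - Complex.I * h) ^ 2)) (by
        refine Measurable.aestronglyMeasurable ?_
        exact (Continuous.measurable (by fun_prop)).div (continuous_stieltjes_denom h).measurable) (by
        have : ∀ᵐ q ∂(unitMeasure.prod (volume : Measure ℝ)), q.1 ∈ Set.Ioo (0 : ℝ) 1 :=
          Measure.quasiMeasurePreserving_fst.ae ae_unitMeasure_mem
        filter_upwards [this] with q hq
        have h2 := hden q.1 hq q.2
        have h3 : 0 < ‖(q.2 : ℂ) ^ 2 - ((q.1 : ℂ) - Complex.I * h) ^ 2‖ := by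
          have : 0 < kernelBound h * ‖(q.2 : ℂ) ^ 2 - ((q.1 : ℂ) - Complex.I * h) ^ 2‖ :=
            lt_of_lt_of_le (by positivity) h2
          exact pos_of_mul_pos_right this (kernelBound_pos h).le
        rw [norm_div, div_le_iff₀ h3, Complex.norm_real, Real.norm_of_nonneg (by positivity)]
        exact h2)
    refine h1.congr (Eventually.of_forall fun q => ?_)
    have : ((1 + q.2 ^ 2 : ℝ) : ℂ) ≠ 0 := by
      exact_mod_cast (by positivity : (1 + q.2 ^ 2 : ℝ) ≠ 0)
    simp only
    rw [mul_assoc, div_mul_div_cancel₀ this]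
  have hfub : (Real.pi : ℂ) * ∫ x, r x * (starRingEnd ℂ) (g (x + Complex.I * ε)) ∂unitMeasure
      = ∫ s : ℝ, (u s : ℂ) * ∫ x, r x / (((s ^ 2 : ℝ) : ℂ) - ((x : ℂ) - Complex.I * h) ^ 2)
        ∂unitMeasure := by
    rw [← integral_const_mul]
    have h1 : ∀ x : ℝ, (Real.pi : ℂ) * (r x * (starRingEnd ℂ) (g (x + Complex.I * ε)))
        = ∫ s : ℝ, r x * ((u s : ℂ) / ((s : ℂ) ^ 2 - ((x : ℂ) - Complex.I * h) ^ 2)) := by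
      intro x
      rw [integral_const_mul, ← hrep]; ring
    simp_rw [h1]
    rw [integral_integral_swap hprod]
    refine integral_congr_ae (Eventually.of_forall fun s => ?_)
    simp only
    rw [← integral_const_mul]
    refine integral_congr_ae (Eventually.of_forall fun x => ?_)
    simp only
    push_cast
    ring
  have hint : Integrable fun s : ℝ => (u s : ℂ) *
      ∫ x, r x / (((s ^ 2 : ℝ) : ℂ) - ((x : ℂ) - Complex.I * h) ^ 2) ∂unitMeasure := by
    refine hprod.integral_prod_right.congr (Eventually.of_forall fun s => ?_)
    simp only
    rw [← integral_const_mul]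
    refine integral_congr_ae (Eventually.of_forall fun x => ?_)
    simp only
    push_cast
    ring
  have hfin : 0 ≤ ((Real.pi : ℂ) *
      ∫ x, r x * (starRingEnd ℂ) (g (x + Complex.I * ε)) ∂unitMeasure).re := by
    rw [hfub]
    have := integral_re hint
    simp only [RCLike.re_eq_complex_re] at this
    rw [← this]
    refine integral_nonneg fun s => ?_
    simp only [Pi.zero_apply]
    rw [Complex.re_ofReal_mul]
    exact mul_nonneg (hu0 s) (hpos _ (sq_nonneg s))
  rw [Complex.re_ofReal_mul] at hfin
  exact (mul_nonneg_iff_of_pos_left Real.pi_pos).1 hfin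

/-- The case of no shift, by letting `ε → 0`. -/
theorem IsAdmissible.re_integral_nonneg {h : ℝ} (hh : 0 < h) {g : ℂ → ℂ}
    (hg : IsAdmissible h g) {r : ℝ → ℂ} (hr : Integrable r unitMeasure)
    (hpos : ∀ s : ℝ, 0 ≤ s →
      0 ≤ (∫ x, r x / ((s : ℂ) - ((x : ℂ) - Complex.I * h) ^ 2) ∂unitMeasure).re) :
    0 ≤ (∫ x, r x * (starRingEnd ℂ) (g x) ∂unitMeasure).re := by
  set G : ℝ × ℝ → ℂ := fun q => g ((q.1 : ℂ) + Complex.I * q.2) with hG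
  have hGc : ContinuousOn G (Set.Icc 0 1 ×ˢ Set.Icc 0 1) :=
    hg.analytic.continuousOn.comp (by fun_prop) fun q hq => by
      have := hq.2.1
      simp [halfPlane]; linarith
  obtain ⟨M, hM⟩ := (isCompact_Icc.prod isCompact_Icc).bddAbove_image hGc.norm
  have hlim : Tendsto (fun ε : ℝ => ∫ x, r x * (starRingEnd ℂ) (g (x + Complex.I * ε)) ∂unitMeasure)
      (𝓝[>] 0) (𝓝 (∫ x, r x * (starRingEnd ℂ) (g x) ∂unitMeasure)) := by
    refine tendsto_integral_filter_of_dominated_convergence (fun x => ‖r x‖ * M) ?_ ?_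
      (hr.norm.mul_const M) ?_
    · filter_upwards [self_mem_nhdsWithin] with ε hε
      refine hr.1.mul (Continuous.aestronglyMeasurable ?_)
      refine Complex.continuous_conj.comp (hg.analytic.continuousOn.comp_continuous (by fun_prop) ?_)
      intro x
      have : 0 < ε := hε
      simp [halfPlane]; linarith
    · filter_upwards [Ioo_mem_nhdsGT (zero_lt_one (α := ℝ))] with ε hε
      filter_upwards [ae_unitMeasure_mem] with x hx
      rw [norm_mul, RCLike.norm_conj]
      gcongr
      exact hM ⟨(x, ε), ⟨Set.Ioo_subset_Icc_self hx, Set.Ioo_subset_Icc_self hε⟩, rfl⟩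
    · refine Eventually.of_forall fun x => Tendsto.const_mul _ ?_
      have h1 : ContinuousAt (fun ε : ℝ => g (x + Complex.I * ε)) 0 := by
        refine ContinuousAt.comp (g := g) ?_ (by fun_prop)
        refine hg.analytic.continuousOn.continuousAt ((isOpen_halfPlane h).mem_nhds ?_)
        simpa using ofReal_mem_halfPlane hh x
      have h2 := (Complex.continuous_conj.continuousAt.comp h1).tendsto.mono_left
        (nhdsWithin_le_nhds (s := Set.Ioi 0))
      simpa [Function.comp_def] using h2
  refine ge_of_tendsto ((Complex.continuous_re.tendsto _).comp hlim) ?_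
  filter_upwards [self_mem_nhdsWithin] with ε hε
  exact hg.re_integral_shift_nonneg hh hr hpos hε

/-! ### Analyticity of the pairing, and moments -/

/-- Integrals of Cauchy type are complex differentiable where the denominator is bounded away from
zero. -/
theorem differentiableAt_integral_div {μ : Measure ℝ} {w α β : ℝ → ℂ} (hw : Integrable w μ)
    (hα : Continuous α) (hβ : Continuous β) {M c : ℝ} (hM : ∀ᵐ x ∂μ, ‖β x‖ ≤ M) (hc0 : 0 < c)
    {z₀ : ℂ} (hc : ∀ᵐ x ∂μ, c ≤ ‖α x + z₀ * β x‖) :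
    DifferentiableAt ℂ (fun z => ∫ x, w x / (α x + z * β x) ∂μ) z₀ := by
  have hden : ∀ z : ℂ, Measurable fun x => α x + z * β x := fun z =>
    (hα.add (continuous_const.mul hβ)).measurable
  have hmeas : ∀ z : ℂ, AEStronglyMeasurable (fun x => w x / (α x + z * β x)) μ := fun z =>
    (hw.1.aemeasurable.div (hden z).aemeasurable).aestronglyMeasurable
  have hM1 : 0 < 2 * (|M| + 1) := by positivity
  have hδ : 0 < c / (2 * (|M| + 1)) := div_pos hc0 hM1
  -- on this ball the denominator moves by at most `c / 2`
  have hloc : ∀ᵐ x ∂μ, ∀ z ∈ Metric.ball z₀ (c / (2 * (|M| + 1))),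
      c / 2 ≤ ‖α x + z * β x‖ := by
    filter_upwards [hM, hc] with x h1 h2 z hz
    rw [Metric.mem_ball, dist_eq_norm] at hz
    have h3 : α x + z₀ * β x = (α x + z * β x) - (z - z₀) * β x := by ring
    have h4 : ‖(z - z₀) * β x‖ ≤ c / 2 := by
      rw [norm_mul]
      calc ‖z - z₀‖ * ‖β x‖ ≤ c / (2 * (|M| + 1)) * (|M| + 1) := by
            gcongr
            linarith [le_abs_self M]
        _ = c / 2 := by field_simp
    have h5 := norm_sub_le (α x + z * β x) ((z - z₀) * β x)
    rw [← h3] at h5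
    linarith
  refine (hasDerivAt_integral_of_dominated_loc_of_deriv_le (μ := μ)
    (F := fun z x => w x / (α x + z * β x)) (F' := fun z x => -(w x * β x) / (α x + z * β x) ^ 2)
    (bound := fun x => ‖w x‖ * (|M| / (c / 2) ^ 2)) (Metric.ball_mem_nhds z₀ hδ)
    (Eventually.of_forall hmeas) ?_ ?_ ?_ (hw.norm.mul_const _) ?_).2.differentiableAt
  · refine (hw.norm.mul_const (1 / c)).mono' (hmeas z₀) ?_
    filter_upwards [hc] with x hx
    rw [norm_div, div_eq_mul_one_div]
    gcongr
  · exact ((hw.1.aemeasurable.mul hβ.measurable.aemeasurable).neg.div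
      ((hden z₀).pow_const 2).aemeasurable).aestronglyMeasurable
  · filter_upwards [hloc, hM] with x hx hMx z hz
    have h1 := hx z hz
    rw [norm_div, norm_neg, norm_mul, norm_pow, mul_div_assoc]
    have : ‖β x‖ ≤ |M| := hMx.trans (le_abs_self M)
    gcongr
  · filter_upwards [hloc] with x hx z hz
    have h1 : α x + z * β x ≠ 0 := norm_pos_iff.1 (lt_of_lt_of_le (half_pos hc0) (hx z hz))
    have h2 : HasDerivAt (fun z : ℂ => α x + z * β x) (β x) z := by
      simpa using ((hasDerivAt_id z).mul_const (β x)).const_add (α x)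
    have h3 := (hasDerivAt_const z (w x)).fun_div h2 h1
    rwa [zero_mul, zero_sub] at h3

theorem analyticAt_integral_div {μ : Measure ℝ} {w α β : ℝ → ℂ} (hw : Integrable w μ)
    (hα : Continuous α) (hβ : Continuous β) {M c : ℝ} (hM : ∀ᵐ x ∂μ, ‖β x‖ ≤ M) (hc0 : 0 < c)
    {z₀ : ℂ} (hc : ∀ᵐ x ∂μ, c ≤ ‖α x + z₀ * β x‖) :
    AnalyticAt ℂ (fun z => ∫ x, w x / (α x + z * β x) ∂μ) z₀ := by
  rw [Complex.analyticAt_iff_eventually_differentiableAt]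
  have hM1 : 0 < 2 * (|M| + 1) := by positivity
  filter_upwards [Metric.ball_mem_nhds z₀ (div_pos hc0 hM1)] with z hz
  refine differentiableAt_integral_div hw hα hβ hM (half_pos hc0) ?_
  filter_upwards [hM, hc] with x h1 h2
  rw [Metric.mem_ball, dist_eq_norm] at hz
  have h3 : α x + z₀ * β x = (α x + z * β x) - (z - z₀) * β x := by ring
  have h4 : ‖(z - z₀) * β x‖ ≤ c / 2 := by
    rw [norm_mul]
    calc ‖z - z₀‖ * ‖β x‖ ≤ c / (2 * (|M| + 1)) * (|M| + 1) := by
          gcongr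
          linarith [le_abs_self M]
      _ = c / 2 := by field_simp
  have h5 := norm_sub_le (α x + z * β x) ((z - z₀) * β x)
  rw [← h3] at h5
  linarith

theorem norm_conj_unit_denom {h : ℝ} (hh : 0 < h) {x : ℝ} (hx : x ∈ Set.Ioo (0 : ℝ) 1) {θ : ℝ}
    (hθ : θ ∈ Set.Icc (0 : ℝ) 1) :
    1 ≤ kernelBound h * ‖1 - (θ : ℂ) * (1 + ((x : ℂ) - Complex.I * h) ^ 2)‖ :=
  one_le_kernelBound_mul hh (by simpa [abs_of_pos hx.1] using hx.2.le) (by simp [abs_of_pos hh]) hθ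

theorem analyticOnNhd_unitPairing {h : ℝ} (hh : 0 < h) {r : ℝ → ℂ}
    (hr : Integrable r unitMeasure) :
    AnalyticOnNhd ℝ (fun θ : ℝ =>
      (∫ x, r x / (1 - (θ : ℂ) * (1 + ((x : ℂ) - Complex.I * h) ^ 2)) ∂unitMeasure).re)
      (Set.Icc 0 1) := by
  intro θ hθ
  have hB := kernelBound_pos h
  set β : ℝ → ℂ := fun x => -(1 + ((x : ℂ) - Complex.I * h) ^ 2) with hβ
  have hβc : Continuous β := by fun_prop
  have hden : ∀ t x : ℝ, 1 - (t : ℂ) * (1 + ((x : ℂ) - Complex.I * h) ^ 2) = 1 + t * β x := by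
    intro t x; simp only [hβ]; ring
  obtain ⟨M, hM⟩ := (isCompact_Icc (a := (0 : ℝ)) (b := 1)).bddAbove_image hβc.norm.continuousOn
  have h1 : AnalyticAt ℂ (fun z : ℂ => ∫ x, r x / (1 + z * β x) ∂unitMeasure) (θ : ℂ) := by
    refine analyticAt_integral_div hr continuous_const hβc (M := M) (c := 1 / kernelBound h) ?_
      (by positivity) ?_
    · filter_upwards [ae_unitMeasure_mem] with x hx
      exact hM ⟨x, Set.Ioo_subset_Icc_self hx, rfl⟩
    · filter_upwards [ae_unitMeasure_mem] with x hx
      rw [div_le_iff₀ hB, mul_comm]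
      rw [← hden]
      exact norm_conj_unit_denom hh hx hθ
  simp_rw [hden]
  exact h1.re_ofReal

/-- The zeros of a nonzero real analytic function on `[0, 1]` cannot accumulate. -/
theorem finite_zeros_unitPairing {h : ℝ} (hh : 0 < h) {r : ℝ → ℂ}
    (hr : Integrable r unitMeasure) {θ₀ : ℝ} (hθ₀ : θ₀ ∈ Set.Icc (0 : ℝ) 1)
    (hne : (∫ x, r x / (1 - (θ₀ : ℂ) * (1 + ((x : ℂ) - Complex.I * h) ^ 2)) ∂unitMeasure).re ≠ 0) :
    {θ : ℝ | θ ∈ Set.Icc (0 : ℝ) 1 ∧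
      (∫ x, r x / (1 - (θ : ℂ) * (1 + ((x : ℂ) - Complex.I * h) ^ 2)) ∂unitMeasure).re
        = 0}.Finite := by
  by_contra hinf
  obtain ⟨a, ha, hacc⟩ := Set.Infinite.exists_accPt_of_subset_isCompact hinf
    (isCompact_Icc (a := (0 : ℝ)) (b := 1)) fun θ hθ => hθ.1
  rw [accPt_iff_frequently_nhdsNE] at hacc
  refine hne ((analyticOnNhd_unitPairing hh hr).eqOn_zero_of_preconnected_of_frequently_eq_zero
    isPreconnected_Icc ha (hacc.mono fun θ hθ => hθ.2) hθ₀)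

/-- The value at infinity of the Caprini function, before taking the real part. -/
theorem tendsto_mul_pairing {h : ℝ} (hh : 0 < h) {r : ℝ → ℂ} (hr : Integrable r unitMeasure) :
    Tendsto (fun s : ℝ => (s : ℂ) * ∫ x, r x / ((s : ℂ) - ((x : ℂ) - Complex.I * h) ^ 2) ∂unitMeasure)
      atTop (𝓝 (∫ x, r x ∂unitMeasure)) := by
  simp_rw [← integral_const_mul]
  refine tendsto_integral_filter_of_dominated_convergence (fun x => ‖r x‖ * kernelBound h) ?_ ?_
    (hr.norm.mul_const _) ?_
  · refine Eventually.of_forall fun s => ?_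
    exact (aemeasurable_const.mul (hr.1.aemeasurable.div
      (Continuous.measurable (by fun_prop)).aemeasurable)).aestronglyMeasurable
  · filter_upwards [eventually_ge_atTop 0] with s hs
    filter_upwards [ae_unitMeasure_mem] with x hx
    have h1 := one_add_le_kernelBound_mul hh (z := (x : ℂ) - Complex.I * h) (s := s)
      (by simpa [abs_of_pos hx.1] using hx.2.le) (by simp [abs_of_pos hh]) hs
    have h2 : 0 < ‖(s : ℂ) - ((x : ℂ) - Complex.I * h) ^ 2‖ :=
      pos_of_mul_pos_right (lt_of_lt_of_le (by positivity) h1) (kernelBound_pos h).le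
    rw [norm_mul, norm_div, Complex.norm_real, Real.norm_of_nonneg hs, mul_div_left_comm]
    gcongr
    rw [div_le_iff₀ h2]
    linarith
  · refine Eventually.of_forall fun x => ?_
    set b : ℂ := ((x : ℂ) - Complex.I * h) ^ 2 with hb
    have h1 : Tendsto (fun s : ℝ => r x / (1 - b / (s : ℂ))) atTop (𝓝 (r x / (1 - 0))) := by
      refine Tendsto.div tendsto_const_nhds (tendsto_const_nhds.sub ?_) (by simp)
      have : Tendsto (fun s : ℝ => b * ((s⁻¹ : ℝ) : ℂ)) atTop (𝓝 (b * ((0 : ℝ) : ℂ))) :=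
        (((Complex.continuous_ofReal.tendsto 0).comp tendsto_inv_atTop_zero)).const_mul b
      simpa [div_eq_mul_inv] using this
    rw [sub_zero, div_one] at h1
    refine h1.congr' ?_
    filter_upwards [eventually_gt_atTop 0] with s hs
    have hs' : (s : ℂ) ≠ 0 := by exact_mod_cast hs.ne'
    rw [one_sub_div hs', div_div_eq_mul_div, mul_comm, mul_div_assoc]

/-- The moments `∫ φ x²ⁿ` come out one after the other as `τ → 0`. -/
theorem moments_eq_zero {φ : ℝ → ℝ} (hφ : Integrable φ unitMeasure)
    (h0 : ∀ τ ∈ Set.Ioo (0 : ℝ) 1, ∫ x, φ x / (1 - τ * x ^ 2) ∂unitMeasure = 0) (n : ℕ) :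
    ∫ x, φ x * (x ^ 2) ^ n ∂unitMeasure = 0 := by
  have hpow : ∀ n : ℕ, Integrable (fun x => φ x * (x ^ 2) ^ n) unitMeasure := fun n =>
    hφ.mul_bdd (c := 1) (Continuous.aestronglyMeasurable (by fun_prop)) (by
      filter_upwards [ae_unitMeasure_mem] with x hx
      rw [Real.norm_of_nonneg (by positivity)]
      exact pow_le_one₀ (sq_nonneg x) (pow_le_one₀ hx.1.le hx.2.le))
  have hden : ∀ τ ∈ Set.Ioo (0 : ℝ) 1, ∀ x ∈ Set.Ioo (0 : ℝ) 1, 1 - τ ≤ 1 - τ * x ^ 2 := by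
    intro τ hτ x hx
    have : x ^ 2 ≤ 1 := pow_le_one₀ hx.1.le hx.2.le
    nlinarith [hτ.1]
  have hmeas : ∀ n : ℕ, ∀ τ : ℝ,
      AEStronglyMeasurable (fun x => φ x * (x ^ 2) ^ n / (1 - τ * x ^ 2)) unitMeasure := fun n τ =>
    ((hpow n).1.aemeasurable.div
      (Continuous.measurable (by fun_prop)).aemeasurable).aestronglyMeasurable
  have hq : ∀ n : ℕ, ∀ τ ∈ Set.Ioo (0 : ℝ) 1,
      Integrable (fun x => φ x * (x ^ 2) ^ n / (1 - τ * x ^ 2)) unitMeasure := by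
    intro n τ hτ
    have h1 : 0 < 1 - τ := by linarith [hτ.2]
    refine ((hpow n).norm.mul_const (1 / (1 - τ))).mono' (hmeas n τ) ?_
    filter_upwards [ae_unitMeasure_mem] with x hx
    have h2 := hden τ hτ x hx
    rw [norm_div, div_eq_mul_one_div, Real.norm_of_nonneg (h1.le.trans h2)]
    gcongr
  have hlim : ∀ n : ℕ, (∀ τ ∈ Set.Ioo (0 : ℝ) 1,
      ∫ x, φ x * (x ^ 2) ^ n / (1 - τ * x ^ 2) ∂unitMeasure = 0) →
      ∫ x, φ x * (x ^ 2) ^ n ∂unitMeasure = 0 := by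
    intro n hn
    have h1 : Tendsto (fun τ : ℝ => ∫ x, φ x * (x ^ 2) ^ n / (1 - τ * x ^ 2) ∂unitMeasure)
        (𝓝[>] 0) (𝓝 (∫ x, φ x * (x ^ 2) ^ n ∂unitMeasure)) := by
      refine tendsto_integral_filter_of_dominated_convergence
        (fun x => ‖φ x * (x ^ 2) ^ n‖ * 2) (Eventually.of_forall (hmeas n)) ?_
        ((hpow n).norm.mul_const 2) ?_
      · filter_upwards [Ioo_mem_nhdsGT (show (0 : ℝ) < 1 / 2 by norm_num)] with τ hτ
        filter_upwards [ae_unitMeasure_mem] with x hx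
        have h2 := hden τ ⟨hτ.1, by linarith [hτ.2]⟩ x hx
        have h3 : 1 / 2 ≤ 1 - τ * x ^ 2 := by linarith [hτ.2]
        rw [norm_div, Real.norm_of_nonneg (r := 1 - τ * x ^ 2) (by linarith),
          div_le_iff₀ (by linarith)]
        nlinarith [norm_nonneg (φ x * (x ^ 2) ^ n)]
      · refine Eventually.of_forall fun x => ?_
        have h2 : ContinuousAt (fun τ : ℝ => φ x * (x ^ 2) ^ n / (1 - τ * x ^ 2)) 0 :=
          ContinuousAt.div (by fun_prop) (by fun_prop) (by simp)
        simpa using h2.tendsto.mono_left (nhdsWithin_le_nhds (s := Set.Ioi 0))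
    have h2 : Tendsto (fun τ : ℝ => ∫ x, φ x * (x ^ 2) ^ n / (1 - τ * x ^ 2) ∂unitMeasure)
        (𝓝[>] 0) (𝓝 0) := by
      refine tendsto_const_nhds.congr' ?_
      filter_upwards [Ioo_mem_nhdsGT (zero_lt_one (α := ℝ))] with τ hτ
      exact (hn τ hτ).symm
    exact tendsto_nhds_unique h1 h2
  have hall : ∀ n : ℕ, ∀ τ ∈ Set.Ioo (0 : ℝ) 1,
      ∫ x, φ x * (x ^ 2) ^ n / (1 - τ * x ^ 2) ∂unitMeasure = 0 := by
    intro n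
    induction n with
    | zero => simpa using h0
    | succ n ih =>
      intro τ hτ
      have h1 : ∫ x, φ x * (x ^ 2) ^ (n + 1) / (1 - τ * x ^ 2) ∂unitMeasure
          = ∫ x, 1 / τ * (φ x * (x ^ 2) ^ n / (1 - τ * x ^ 2) - φ x * (x ^ 2) ^ n)
            ∂unitMeasure := by
        refine integral_congr_ae ?_
        filter_upwards [ae_unitMeasure_mem] with x hx
        have h2 := hden τ hτ x hx
        have h3 : 1 - τ * x ^ 2 ≠ 0 := by linarith [hτ.2]
        have h4 := hτ.1.ne'
        have h5 : φ x * (x ^ 2) ^ n / (1 - τ * x ^ 2) - φ x * (x ^ 2) ^ n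
            = τ * (φ x * (x ^ 2) ^ (n + 1) / (1 - τ * x ^ 2)) := by
          rw [← mul_div_assoc, eq_div_iff h3, sub_mul, div_mul_cancel₀ _ h3]; ring
        rw [h5, ← mul_assoc, one_div_mul_cancel h4, one_mul]
      rw [h1, integral_const_mul, integral_sub (hq n τ hτ) (hpow n), ih τ hτ, hlim n ih]
      simp
  exact hlim n (hall n)

/-- Polynomials in `x²` are uniformly dense in the continuous functions on `[0, 1]`. -/
theorem ae_eq_zero_of_moments {φ : ℝ → ℝ} (hφ : Integrable φ unitMeasure)
    (h0 : ∀ n : ℕ, ∫ x, φ x * (x ^ 2) ^ n ∂unitMeasure = 0) : φ =ᵐ[unitMeasure] 0 := by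
  have hpow : ∀ n : ℕ, Integrable (fun x => φ x * (x ^ 2) ^ n) unitMeasure := fun n =>
    hφ.mul_bdd (c := 1) (Continuous.aestronglyMeasurable (by fun_prop)) (by
      filter_upwards [ae_unitMeasure_mem] with x hx
      rw [Real.norm_of_nonneg (by positivity)]
      exact pow_le_one₀ (sq_nonneg x) (pow_le_one₀ hx.1.le hx.2.le))
  have hpoly : ∀ p : Polynomial ℝ, Integrable (fun x => φ x * p.eval (x ^ 2)) unitMeasure ∧
      ∫ x, φ x * p.eval (x ^ 2) ∂unitMeasure = 0 := by
    intro p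
    induction p using Polynomial.induction_on' with
    | add p q hp hq =>
      simp only [Polynomial.eval_add, mul_add]
      exact ⟨hp.1.add hq.1, by rw [integral_add hp.1 hq.1, hp.2, hq.2, add_zero]⟩
    | monomial n a =>
      have h1 : ∀ x : ℝ, φ x * (Polynomial.monomial n a).eval (x ^ 2) = a * (φ x * (x ^ 2) ^ n) := by
        intro x; rw [Polynomial.eval_monomial]; ring
      simp_rw [h1]
      exact ⟨(hpow n).const_mul a, by rw [integral_const_mul, h0, mul_zero]⟩
  refine ae_eq_zero_of_integral_contDiff_smul_eq_zero hφ.locallyIntegrable fun g hg _ => ?_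
  have hbound : ∀ ε : ℝ, 0 < ε → |∫ x, g x • φ x ∂unitMeasure| ≤ ε * ∫ x, ‖φ x‖ ∂unitMeasure := by
    intro ε hε
    obtain ⟨p, hp⟩ := exists_polynomial_near_of_continuousOn 0 1 (fun y => g (√y))
      (hg.continuous.comp Real.continuous_sqrt).continuousOn ε hε
    have hgi : Integrable (fun x => g x • φ x) unitMeasure := by
      obtain ⟨M, hM⟩ := (isCompact_Icc (a := (0 : ℝ)) (b := 1)).bddAbove_image
        hg.continuous.norm.continuousOn
      refine hφ.bdd_mul (c := M) hg.continuous.aestronglyMeasurable ?_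
      filter_upwards [ae_unitMeasure_mem] with x hx
      exact hM ⟨x, Set.Ioo_subset_Icc_self hx, rfl⟩
    have h1 : ∫ x, g x • φ x ∂unitMeasure
        = ∫ x, (g x • φ x - φ x * p.eval (x ^ 2)) ∂unitMeasure := by
      rw [integral_sub hgi (hpoly p).1, (hpoly p).2, sub_zero]
    rw [h1, ← Real.norm_eq_abs, ← integral_const_mul]
    refine norm_integral_le_of_norm_le (hφ.norm.const_mul ε) ?_
    filter_upwards [ae_unitMeasure_mem] with x hx
    have h2 := hp (x ^ 2) ⟨sq_nonneg x, pow_le_one₀ hx.1.le hx.2.le⟩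
    rw [Real.sqrt_sq hx.1.le, abs_sub_comm] at h2
    have h3 : g x • φ x - φ x * p.eval (x ^ 2) = (g x - p.eval (x ^ 2)) * φ x := by
      rw [smul_eq_mul]; ring
    rw [h3, norm_mul, Real.norm_eq_abs (g x - _)]
    gcongr
  have hlim : Tendsto (fun ε : ℝ => ε * ∫ x, ‖φ x‖ ∂unitMeasure) (𝓝[>] 0) (𝓝 0) := by
    have : Tendsto (fun ε : ℝ => ε * ∫ x, ‖φ x‖ ∂unitMeasure) (𝓝 0)
        (𝓝 (0 * ∫ x, ‖φ x‖ ∂unitMeasure)) := Continuous.tendsto (by fun_prop) 0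
    rw [zero_mul] at this
    exact this.mono_left nhdsWithin_le_nhds
  have h2 : |∫ x, g x • φ x ∂unitMeasure| ≤ 0 := by
    refine ge_of_tendsto hlim ?_
    filter_upwards [self_mem_nhdsWithin] with ε hε
    exact hbound ε hε
  exact abs_nonpos_iff.1 h2

/-! ### Density of the kernels -/

/-- The function `∫ r(x) / (v + x) dx + ∫ conj (r(x)) / (v - x) dx`, the Cauchy transform of the
density on `[-1, 1]` that equals `conj r` on the right half and the reflection of `r` on the left
half. The factor `1` in `v * 1` matches the linear denominators `α + v β` of
`differentiableAt_integral_div`. -/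
def symmCauchy (r : ℝ → ℂ) (v : ℂ) : ℂ :=
  ∫ x, r x / ((x : ℂ) + v * 1) ∂unitMeasure +
    ∫ x, (starRingEnd ℂ) (r x) / (-(x : ℂ) + v * 1) ∂unitMeasure

theorem integrable_conj {r : ℝ → ℂ} (hr : Integrable r unitMeasure) :
    Integrable (fun x => (starRingEnd ℂ) (r x)) unitMeasure :=
  (LinearIsometryEquiv.integrable_comp_iff Complex.conjLIE).2 hr

theorem differentiableAt_symmCauchy {r : ℝ → ℂ} (hr : Integrable r unitMeasure) {v : ℂ} {c : ℝ}
    (hc : 0 < c) (h1 : ∀ x ∈ Set.Ioo (0 : ℝ) 1, c ≤ ‖(x : ℂ) + v‖)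
    (h2 : ∀ x ∈ Set.Ioo (0 : ℝ) 1, c ≤ ‖-(x : ℂ) + v‖) :
    DifferentiableAt ℂ (symmCauchy r) v := by
  refine DifferentiableAt.add
    (differentiableAt_integral_div hr (by fun_prop) continuous_const (M := 1) (by simp) hc ?_)
    (differentiableAt_integral_div (integrable_conj hr) (by fun_prop) continuous_const (M := 1)
      (by simp) hc ?_)
  · filter_upwards [ae_unitMeasure_mem] with x hx
    simpa using h1 x hx
  · filter_upwards [ae_unitMeasure_mem] with x hx
    simpa using h2 x hx

theorem differentiableAt_symmCauchy_of_im {r : ℝ → ℂ} (hr : Integrable r unitMeasure) {v : ℂ}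
    (hv : v.im ≠ 0) : DifferentiableAt ℂ (symmCauchy r) v := by
  refine differentiableAt_symmCauchy hr (abs_pos.2 hv) (fun x _ => ?_) (fun x _ => ?_)
  · simpa using Complex.abs_im_le_norm ((x : ℂ) + v)
  · simpa using Complex.abs_im_le_norm (-(x : ℂ) + v)

theorem differentiableAt_symmCauchy_of_re {r : ℝ → ℂ} (hr : Integrable r unitMeasure) {v : ℂ}
    (hv : 1 < v.re) : DifferentiableAt ℂ (symmCauchy r) v := by
  refine differentiableAt_symmCauchy hr (sub_pos.2 hv) (fun x hx => ?_) (fun x hx => ?_)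
  · have := (le_abs_self _).trans (Complex.abs_re_le_norm ((x : ℂ) + v))
    simp at this
    linarith [hx.1]
  · have := (le_abs_self _).trans (Complex.abs_re_le_norm (-(x : ℂ) + v))
    simp at this
    linarith [hx.2]

theorem norm_symmCauchy_le {r : ℝ → ℂ} (hr : Integrable r unitMeasure) {v : ℂ} (hv : 1 < ‖v‖) :
    ‖symmCauchy r v‖ ≤ 2 * (∫ x, ‖r x‖ ∂unitMeasure) / (‖v‖ - 1) := by
  have h0 : 0 < ‖v‖ - 1 := sub_pos.2 hv
  have key : ∀ w : ℝ → ℂ, (∀ x, ‖w x‖ = ‖r x‖) → ∀ a : ℝ → ℂ, (∀ x ∈ Set.Ioo (0 : ℝ) 1, ‖a x‖ ≤ 1) →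
      ‖∫ x, w x / (a x + v * 1) ∂unitMeasure‖ ≤ (∫ x, ‖r x‖ ∂unitMeasure) * (1 / (‖v‖ - 1)) := by
    intro w hw a ha
    rw [← integral_mul_const]
    refine norm_integral_le_of_norm_le (hr.norm.mul_const _) ?_
    filter_upwards [ae_unitMeasure_mem] with x hx
    have h1 : ‖v‖ - 1 ≤ ‖a x + v * 1‖ := by
      have := norm_sub_norm_le v (-a x)
      rw [norm_neg, sub_neg_eq_add, add_comm v] at this
      rw [mul_one]
      linarith [ha x hx]
    rw [norm_div, hw, div_eq_mul_one_div]
    gcongr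
  have h1 := key r (fun _ => rfl) (fun x => (x : ℂ)) fun x hx => by
    simpa [abs_of_pos hx.1] using hx.2.le
  have h2 := key (fun x => (starRingEnd ℂ) (r x)) (fun _ => RCLike.norm_conj _) (fun x => -(x : ℂ))
    fun x hx => by simpa [abs_of_pos hx.1] using hx.2.le
  refine (norm_add_le _ _).trans ((add_le_add h1 h2).trans (le_of_eq ?_))
  ring

theorem tendsto_symmCauchy {r : ℝ → ℂ} (hr : Integrable r unitMeasure) :
    Tendsto (symmCauchy r) (cocompact ℂ) (𝓝 0) := by
  have hn : Tendsto (fun v : ℂ => ‖v‖) (cocompact ℂ) atTop := tendsto_norm_cocompact_atTop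
  refine squeeze_zero_norm' (a := fun v : ℂ => 2 * (∫ x, ‖r x‖ ∂unitMeasure) / (‖v‖ - 1)) ?_ ?_
  · filter_upwards [hn.eventually_gt_atTop 1] with v hv
    exact norm_symmCauchy_le hr hv
  · exact tendsto_const_nhds.div_atTop (tendsto_atTop_add_const_right _ _ hn)

/-- Partial fractions of `1 / (ζ² - (x - i h)²)` and of its conjugate, for real `ζ`. -/
theorem symmCauchy_sub_eq {h : ℝ} (hh : 0 < h) {r : ℝ → ℂ} (hr : Integrable r unitMeasure)
    (ζ : ℝ) : symmCauchy r (ζ - Complex.I * h) - symmCauchy r (-ζ - Complex.I * h)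
      = 4 * ζ * (∫ x, r x / (((ζ ^ 2 : ℝ) : ℂ) - ((x : ℂ) - Complex.I * h) ^ 2) ∂unitMeasure).re := by
  have hne : ∀ a : ℂ, a.im ≠ 0 → a ≠ 0 := fun a ha h0 => ha (by simp [h0])
  have hint : ∀ w : ℝ → ℂ, Integrable w unitMeasure → ∀ a : ℝ → ℂ, Continuous a →
      ∀ v : ℂ, (∀ x, h ≤ |(a x + v * 1).im|) →
      Integrable (fun x => w x / (a x + v * 1)) unitMeasure := by
    intro w hw a ha v hv
    refine (hw.norm.mul_const (1 / h)).mono' ?_ ?_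
    · exact (hw.1.aemeasurable.div
        (ha.add continuous_const).measurable.aemeasurable).aestronglyMeasurable
    · refine Eventually.of_forall fun x => ?_
      rw [norm_div, div_eq_mul_one_div]
      have := (hv x).trans (Complex.abs_im_le_norm _)
      gcongr
  have alg : ∀ w A B z : ℂ, A ≠ 0 → B ≠ 0 → B = A - 2 * z →
      w / A - w / B = 2 * z * (w / -(A * B)) := by
    rintro w A _ z hA hB rfl
    field_simp
    ring
  have hc := integrable_conj hr
  have hx : Continuous fun x : ℝ => (x : ℂ) := Complex.continuous_ofReal
  have i1 := hint r hr _ hx (ζ - Complex.I * h) (fun x => by simp [abs_of_pos hh])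
  have i2 := hint _ hc (fun x => -(x : ℂ)) hx.neg (ζ - Complex.I * h) (fun x => by simp [abs_of_pos hh])
  have i3 := hint r hr _ hx (-ζ - Complex.I * h) (fun x => by simp [abs_of_pos hh])
  have i4 := hint _ hc (fun x => -(x : ℂ)) hx.neg (-ζ - Complex.I * h) (fun x => by simp [abs_of_pos hh])
  have e1 : ∫ x, r x / ((x : ℂ) + ((ζ : ℂ) - Complex.I * h) * 1) ∂unitMeasure
      - ∫ x, r x / ((x : ℂ) + (-(ζ : ℂ) - Complex.I * h) * 1) ∂unitMeasure
      = 2 * ζ * ∫ x, r x / (((ζ ^ 2 : ℝ) : ℂ) - ((x : ℂ) - Complex.I * h) ^ 2) ∂unitMeasure := by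
    rw [← integral_sub i1 i3, ← integral_const_mul]
    refine integral_congr_ae (Eventually.of_forall fun x => ?_)
    have h1 := hne ((x : ℂ) + ((ζ : ℂ) - Complex.I * h) * 1) (by simp [hh.ne'])
    have h2 := hne ((x : ℂ) + (-(ζ : ℂ) - Complex.I * h) * 1) (by simp [hh.ne'])
    have h3 : (((ζ ^ 2 : ℝ) : ℂ) - ((x : ℂ) - Complex.I * h) ^ 2)
        = -((x + ((ζ : ℂ) - Complex.I * h) * 1) * (x + (-(ζ : ℂ) - Complex.I * h) * 1)) := by
      push_cast; ring
    simp only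
    rw [h3]
    exact alg _ _ _ _ h1 h2 (by ring)
  have e2 : ∫ x, (starRingEnd ℂ) (r x) / (-(x : ℂ) + ((ζ : ℂ) - Complex.I * h) * 1) ∂unitMeasure
      - ∫ x, (starRingEnd ℂ) (r x) / (-(x : ℂ) + (-(ζ : ℂ) - Complex.I * h) * 1) ∂unitMeasure
      = 2 * ζ * (starRingEnd ℂ)
        (∫ x, r x / (((ζ ^ 2 : ℝ) : ℂ) - ((x : ℂ) - Complex.I * h) ^ 2) ∂unitMeasure) := by
    rw [← integral_sub i2 i4, ← integral_conj, ← integral_const_mul]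
    refine integral_congr_ae (Eventually.of_forall fun x => ?_)
    have h1 := hne (-(x : ℂ) + ((ζ : ℂ) - Complex.I * h) * 1) (by simp [hh.ne'])
    have h2 := hne (-(x : ℂ) + (-(ζ : ℂ) - Complex.I * h) * 1) (by simp [hh.ne'])
    have h3 : (starRingEnd ℂ) (((ζ ^ 2 : ℝ) : ℂ) - ((x : ℂ) - Complex.I * h) ^ 2)
        = -((-x + ((ζ : ℂ) - Complex.I * h) * 1) * (-x + (-(ζ : ℂ) - Complex.I * h) * 1)) := by
      simp only [map_sub, map_pow, map_mul, Complex.conj_ofReal, Complex.conj_I]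
      push_cast; ring
    simp only [map_div₀]
    rw [h3]
    exact alg _ _ _ _ h1 h2 (by ring)
  have e3 := Complex.add_conj
    (∫ x, r x / (((ζ ^ 2 : ℝ) : ℂ) - ((x : ℂ) - Complex.I * h) ^ 2) ∂unitMeasure)
  unfold symmCauchy
  simp only [Complex.ofReal_mul, Complex.ofReal_ofNat] at e3
  linear_combination e1 + e2 + 2 * ζ * e3

/-- The gluing argument: `U(ζ - i h)` and `U(-ζ - i h)` agree on the strip `|Im ζ| < h`, since they
agree on the real line. -/
theorem symmCauchy_eq_zero_of_im_neg {h : ℝ} (hh : 0 < h) {r : ℝ → ℂ}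
    (hr : Integrable r unitMeasure)
    (h0 : ∀ s : ℝ, 0 ≤ s →
      (∫ x, r x / ((s : ℂ) - ((x : ℂ) - Complex.I * h) ^ 2) ∂unitMeasure).re = 0)
    {v : ℂ} (hv : v.im < 0) : symmCauchy r v = 0 := by
  set lo : ℂ → ℂ := fun ζ => symmCauchy r (ζ - Complex.I * h) with hlo
  set up : ℂ → ℂ := fun ζ => symmCauchy r (-ζ - Complex.I * h) with hup
  have hlod : ∀ ζ : ℂ, ζ.im < h → DifferentiableAt ℂ lo ζ := fun ζ hζ =>
    DifferentiableAt.comp (g := symmCauchy r) ζ (differentiableAt_symmCauchy_of_im hr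
      (by simp; linarith)) (by fun_prop)
  have hupd : ∀ ζ : ℂ, -h < ζ.im → DifferentiableAt ℂ up ζ := fun ζ hζ =>
    DifferentiableAt.comp (g := symmCauchy r) ζ (differentiableAt_symmCauchy_of_im hr
      (by simp; linarith)) (by fun_prop)
  set S : Set ℂ := {ζ | -h < ζ.im} ∩ {ζ | ζ.im < h} with hS
  have hSo : IsOpen S := (isOpen_lt continuous_const Complex.continuous_im).inter
    (isOpen_lt Complex.continuous_im continuous_const)
  have hSc : Convex ℝ S := (convex_halfSpace_im_gt _).inter (convex_halfSpace_im_lt _)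
  have heq : Set.EqOn lo up S := by
    have ha : AnalyticOnNhd ℂ lo S := DifferentiableOn.analyticOnNhd
      (fun ζ hζ => (hlod ζ hζ.2).differentiableWithinAt) hSo
    have hb : AnalyticOnNhd ℂ up S := DifferentiableOn.analyticOnNhd
      (fun ζ hζ => (hupd ζ hζ.1).differentiableWithinAt) hSo
    refine ha.eqOn_of_preconnected_of_frequently_eq hb hSc.isPreconnected
      (z₀ := ((1 : ℝ) : ℂ)) (by simp [hS, hh]) ?_
    have h3 : Tendsto (fun x : ℝ => (x : ℂ)) (𝓝[>] 1) (𝓝[≠] ((1 : ℝ) : ℂ)) := by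
      refine tendsto_nhdsWithin_of_tendsto_nhds_of_eventually_within _
        ((Complex.continuous_ofReal.tendsto _).mono_left nhdsWithin_le_nhds) ?_
      filter_upwards [self_mem_nhdsWithin] with x hx
      exact fun hx' => (ne_of_gt (Set.mem_Ioi.1 hx)) (Complex.ofReal_injective hx')
    refine h3.frequently (Eventually.frequently ?_)
    refine Eventually.of_forall fun x => ?_
    have := symmCauchy_sub_eq hh hr x
    rw [h0 _ (sq_nonneg x)] at this
    exact sub_eq_zero.1 (by simpa using this)
  -- the two branches glue to an entire function that vanishes at infinity
  set E : ℂ → ℂ := fun ζ => if ζ.im < h then lo ζ else up ζ with hE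
  have hEup : ∀ ζ : ℂ, -h < ζ.im → E ζ = up ζ := by
    intro ζ hζ
    by_cases h1 : ζ.im < h
    · simp only [hE, h1, if_true]; exact heq ⟨hζ, h1⟩
    · simp only [hE, h1, if_false]
  have hEd : Differentiable ℂ E := by
    intro ζ
    by_cases h1 : ζ.im < h
    · refine (hlod ζ h1).congr_of_eventuallyEq ?_
      filter_upwards [(isOpen_lt Complex.continuous_im continuous_const).mem_nhds h1] with w hw
      have : w.im < h := hw
      simp only [hE, this, if_true]
    · have h2 : -h < ζ.im := by linarith [not_lt.1 h1]
      refine (hupd ζ h2).congr_of_eventuallyEq ?_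
      filter_upwards [(isOpen_lt continuous_const Complex.continuous_im).mem_nhds h2] with w hw
      exact hEup w hw
  have hlot : Tendsto lo (cocompact ℂ) (𝓝 0) :=
    (tendsto_symmCauchy hr).comp (Homeomorph.subRight (Complex.I * (h : ℂ))).isClosedEmbedding.tendsto_cocompact
  have hupt : Tendsto up (cocompact ℂ) (𝓝 0) := by
    have := hlot.comp (Homeomorph.neg ℂ).isClosedEmbedding.tendsto_cocompact
    exact this
  have hEt : Tendsto E (cocompact ℂ) (𝓝 0) := hlot.if' hupt
  have h1 := hEd.apply_eq_of_tendsto_cocompact (v + Complex.I * h) hEt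
  have h2 : (v + Complex.I * h).im < h := by simpa using hv
  simp only [hE, h2, if_true, hlo, add_sub_cancel_right] at h1
  exact h1

/-- The half-plane `Re v > 1` avoids the segment `[-1, 1]` and meets `Im v < 0`. -/
theorem symmCauchy_eq_zero_of_one_lt_re {h : ℝ} (hh : 0 < h) {r : ℝ → ℂ}
    (hr : Integrable r unitMeasure)
    (h0 : ∀ s : ℝ, 0 ≤ s →
      (∫ x, r x / ((s : ℂ) - ((x : ℂ) - Complex.I * h) ^ 2) ∂unitMeasure).re = 0)
    {v : ℂ} (hv : 1 < v.re) : symmCauchy r v = 0 := by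
  have ho : IsOpen {v : ℂ | 1 < v.re} := isOpen_lt continuous_const Complex.continuous_re
  have ha : AnalyticOnNhd ℂ (symmCauchy r) {v : ℂ | 1 < v.re} := DifferentiableOn.analyticOnNhd
    (fun v hv => (differentiableAt_symmCauchy_of_re hr hv).differentiableWithinAt) ho
  have hmem : (2 - Complex.I : ℂ) ∈ {v : ℂ | 1 < v.re} := by simp
  refine ha.eqOn_zero_of_preconnected_of_eventuallyEq_zero
    (convex_halfSpace_re_gt 1).isPreconnected hmem ?_ hv
  filter_upwards [(isOpen_lt Complex.continuous_im continuous_const).mem_nhds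
    (show (2 - Complex.I : ℂ).im < 0 by simp)] with w hw
  exact symmCauchy_eq_zero_of_im_neg hh hr h0 hw

/-- The kernels `1 / (s - (x + i h)²)`, `s ≥ 0`, span a dense real subspace of `L²(0, 1)`. The real
and imaginary parts of `U(v)` for real `v > 1` separate into the transforms
`∫ φ(x) / (1 - τ x²) dx`, `τ = v⁻²`, of `φ = Re r` and of `φ = x Im r`. -/
theorem ae_eq_zero_of_pairing_eq_zero {h : ℝ} (hh : 0 < h) {r : ℝ → ℂ}
    (hr : Integrable r unitMeasure)
    (h0 : ∀ s : ℝ, 0 ≤ s →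
      (∫ x, r x / ((s : ℂ) - ((x : ℂ) - Complex.I * h) ^ 2) ∂unitMeasure).re = 0) :
    r =ᵐ[unitMeasure] 0 := by
  have hre : Integrable (fun x => (r x).re) unitMeasure := hr.re
  have him : Integrable (fun x => (r x).im) unitMeasure := hr.im
  have hxim : Integrable (fun x => x * (r x).im) unitMeasure :=
    him.bdd_mul (c := 1) continuous_id.aestronglyMeasurable (by
      filter_upwards [ae_unitMeasure_mem] with x hx
      exact (Real.norm_of_nonneg hx.1.le).le.trans hx.2.le)
  have hden : ∀ τ ∈ Set.Ioo (0 : ℝ) 1, ∀ x ∈ Set.Ioo (0 : ℝ) 1, 1 - τ ≤ 1 - τ * x ^ 2 := by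
    intro τ hτ x hx
    have : x ^ 2 ≤ 1 := pow_le_one₀ hx.1.le hx.2.le
    nlinarith [hτ.1]
  have hdiv : ∀ φ : ℝ → ℝ, Integrable φ unitMeasure → ∀ τ ∈ Set.Ioo (0 : ℝ) 1,
      Integrable (fun x => φ x / (1 - τ * x ^ 2)) unitMeasure := by
    intro φ hφ τ hτ
    have h1 : 0 < 1 - τ := by linarith [hτ.2]
    refine (hφ.norm.mul_const (1 / (1 - τ))).mono' ((hφ.1.aemeasurable.div
      (Continuous.measurable (by fun_prop)).aemeasurable).aestronglyMeasurable) ?_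
    filter_upwards [ae_unitMeasure_mem] with x hx
    have h2 := hden τ hτ x hx
    rw [norm_div, div_eq_mul_one_div, Real.norm_of_nonneg (h1.le.trans h2)]
    gcongr
  have hsplit : ∀ τ ∈ Set.Ioo (0 : ℝ) 1,
      ∫ x, (r x).re / (1 - τ * x ^ 2) ∂unitMeasure = 0 ∧
      ∫ x, (x * (r x).im) / (1 - τ * x ^ 2) ∂unitMeasure = 0 := by
    intro τ hτ
    -- evaluate at the real point `v = τ^(-1/2) > 1`
    set v : ℝ := (√τ)⁻¹ with hv
    have hs0 : 0 < √τ := Real.sqrt_pos.2 hτ.1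
    have hs1 : √τ < 1 := by rw [Real.sqrt_lt' one_pos]; linarith [hτ.2]
    have hv1 : 1 < v := (one_lt_inv₀ hs0).2 hs1
    have hv0 : 0 < v := by linarith
    have hvτ : τ * v ^ 2 = 1 := by
      rw [hv, inv_pow, Real.sq_sqrt hτ.1.le, mul_inv_cancel₀ hτ.1.ne']
    have hU := symmCauchy_eq_zero_of_one_lt_re hh hr h0 (v := (v : ℂ)) (by simpa using hv1)
    have hint : ∀ w : ℝ → ℂ, Integrable w unitMeasure → ∀ a : ℝ → ℝ, Continuous a →
        (∀ x ∈ Set.Ioo (0 : ℝ) 1, -1 ≤ a x) →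
        Integrable (fun x => w x / ((a x : ℂ) + v * 1)) unitMeasure := by
      intro w hw a ha hax
      refine (hw.norm.mul_const (1 / (v - 1))).mono' ?_ ?_
      · exact (hw.1.aemeasurable.div
          (Continuous.measurable (by fun_prop)).aemeasurable).aestronglyMeasurable
      · filter_upwards [ae_unitMeasure_mem] with x hx
        rw [norm_div, div_eq_mul_one_div]
        have h1 : v - 1 ≤ ‖(a x : ℂ) + v * 1‖ := by
          have h2 : (a x : ℂ) + v * 1 = ((a x + v : ℝ) : ℂ) := by push_cast; ring
          rw [h2, Complex.norm_real]
          exact le_trans (by linarith [hax x hx]) (le_abs_self _)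
        have : 0 < v - 1 := by linarith
        gcongr
    have i1 := hint r hr (fun x => x) continuous_id fun x hx => by linarith [hx.1]
    have i2 := hint _ (integrable_conj hr) (fun x => -x) continuous_neg fun x hx => by linarith [hx.2]
    have hcomb : symmCauchy r v = ∫ x, ((2 / v * ((r x).re / (1 - τ * x ^ 2)) : ℝ) : ℂ)
        + ((-(2 / v ^ 2) * (x * (r x).im / (1 - τ * x ^ 2)) : ℝ) : ℂ) * Complex.I ∂unitMeasure := by
      unfold symmCauchy
      rw [← integral_add i1 (by simpa using i2)]
      refine integral_congr_ae ?_
      filter_upwards [ae_unitMeasure_mem] with x hx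
      have h1 : ((x + v : ℝ) : ℂ) ≠ 0 := by
        exact_mod_cast (by linarith [hx.1] : x + v ≠ 0)
      have h2 : ((-x + v : ℝ) : ℂ) ≠ 0 := by
        exact_mod_cast (by linarith [hx.2] : -x + v ≠ 0)
      have h3 : ((1 - τ * x ^ 2 : ℝ) : ℂ) * (v : ℂ) ^ 2 = ((x + v : ℝ) : ℂ) * ((-x + v : ℝ) : ℂ) := by
        have : (1 - τ * x ^ 2) * v ^ 2 = (x + v) * (-x + v) := by linear_combination -x ^ 2 * hvτ
        exact_mod_cast this
      have h4 : ((1 - τ * x ^ 2 : ℝ) : ℂ) ≠ 0 := by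
        have := hden τ hτ x hx
        exact_mod_cast (by linarith [hτ.2] : 1 - τ * x ^ 2 ≠ 0)
      have h5 : (v : ℂ) ≠ 0 := by exact_mod_cast hv0.ne'
      set a := (r x).re with ha
      set b := (r x).im with hb
      have h6 : r x = a + b * Complex.I := (Complex.re_add_im _).symm
      have h7 : (starRingEnd ℂ) (r x) = a - b * Complex.I :=
        Complex.ext (by simp [ha]) (by simp [hb])
      have e1 : (x : ℂ) + v * 1 = ((x + v : ℝ) : ℂ) := by push_cast; ring
      have e2 : -(x : ℂ) + v * 1 = ((-x + v : ℝ) : ℂ) := by push_cast; ring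
      rw [e1, e2, h7, h6]
      rw [Complex.ofReal_mul, Complex.ofReal_mul, Complex.ofReal_div, Complex.ofReal_div,
        Complex.ofReal_neg, Complex.ofReal_div, Complex.ofReal_div]
      have h8 : ((1 - τ * x ^ 2 : ℝ) : ℂ) = ((x + v : ℝ) : ℂ) * ((-x + v : ℝ) : ℂ) / (v : ℂ) ^ 2 := by
        rw [← h3]; field_simp
      rw [h8]
      field_simp
      push_cast
      ring
    have hI : Integrable (fun x => ((2 / v * ((r x).re / (1 - τ * x ^ 2)) : ℝ) : ℂ)) unitMeasure :=
      ((hdiv _ hre τ hτ).const_mul (2 / v)).ofReal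
    have hJ : Integrable (fun x => ((-(2 / v ^ 2) * (x * (r x).im / (1 - τ * x ^ 2)) : ℝ) : ℂ)
        * Complex.I) unitMeasure :=
      (((hdiv _ hxim τ hτ).const_mul (-(2 / v ^ 2))).ofReal (𝕜 := ℂ)).mul_const Complex.I
    rw [hU] at hcomb
    rw [integral_add hI hJ, integral_mul_const] at hcomb
    rw [integral_complex_ofReal, integral_complex_ofReal, integral_const_mul, integral_const_mul] at hcomb
    have c1 := congrArg Complex.re hcomb
    have c2 := congrArg Complex.im hcomb
    simp only [Complex.zero_re, Complex.zero_im, Complex.add_re, Complex.add_im, Complex.ofReal_re,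
      Complex.ofReal_im, Complex.mul_re, Complex.mul_im, Complex.I_re, Complex.I_im, mul_zero,
      mul_one, sub_zero, add_zero, zero_add] at c1 c2
    exact ⟨(mul_eq_zero.1 c1.symm).resolve_left (by positivity),
      (mul_eq_zero.1 c2.symm).resolve_left (neg_ne_zero.2 (by positivity))⟩
  have z1 := ae_eq_zero_of_moments hre (moments_eq_zero hre fun τ hτ => (hsplit τ hτ).1)
  have z2 := ae_eq_zero_of_moments hxim (moments_eq_zero hxim fun τ hτ => (hsplit τ hτ).2)
  filter_upwards [z1, z2, ae_unitMeasure_mem] with x h1 h2 hx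
  refine Complex.ext (by simpa using h1) ?_
  have : x * (r x).im = 0 := h2
  simpa [hx.1.ne'] using this

/-! ### The minimizer -/

open scoped RealInnerProductSpace

theorem conj_stieltjesKernel (h s x : ℝ) : (starRingEnd ℂ) (stieltjesKernel h s x)
    = 1 / ((s : ℂ) - ((x : ℂ) - Complex.I * h) ^ 2) := by
  simp [stieltjesKernel, sub_eq_add_neg]

theorem conj_unitKernel (h θ x : ℝ) : (starRingEnd ℂ) (unitKernel h θ x)
    = 1 / (1 - (θ : ℂ) * (1 + ((x : ℂ) - Complex.I * h) ^ 2)) := by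
  simp [unitKernel, sub_eq_add_neg]

/-- The pairing `Re ∫ r(x) / (s - (x - i h)²) dx`, which is half of the Caprini function when
`r` is the difference of `f` and `f_exp`. -/
def pairing (h : ℝ) (r : ℝ → ℂ) (s : ℝ) : ℝ :=
  (∫ x, r x / ((s : ℂ) - ((x : ℂ) - Complex.I * h) ^ 2) ∂unitMeasure).re

/-- The pairing with the kernel of parameter `θ`. -/
def unitPairing (h : ℝ) (r : ℝ → ℂ) (θ : ℝ) : ℝ :=
  (∫ x, r x / (1 - (θ : ℂ) * (1 + ((x : ℂ) - Complex.I * h) ^ 2)) ∂unitMeasure).re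

theorem unitPairing_one_div (h : ℝ) (r : ℝ → ℂ) {s : ℝ} (hs : 0 ≤ s) :
    unitPairing h r (1 / (1 + s)) = (1 + s) * pairing h r s := by
  unfold unitPairing pairing
  rw [← Complex.re_ofReal_mul, ← integral_const_mul]
  congr 1
  refine integral_congr_ae (Eventually.of_forall fun x => ?_)
  simp only
  have h1 : ((1 + s : ℝ) : ℂ) ≠ 0 := by exact_mod_cast (by positivity : (1 + s : ℝ) ≠ 0)
  have h2 : 1 - ((1 / (1 + s) : ℝ) : ℂ) * (1 + ((x : ℂ) - Complex.I * h) ^ 2)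
      = ((s : ℂ) - ((x : ℂ) - Complex.I * h) ^ 2) / ((1 + s : ℝ) : ℂ) := by
    rw [eq_div_iff h1, Complex.ofReal_div, Complex.ofReal_one, sub_mul, mul_right_comm,
      one_div_mul_cancel h1]
    push_cast; ring
  rw [h2, div_div_eq_mul_div, mul_comm, mul_div_assoc]

theorem one_div_one_add_mem {s : ℝ} (hs : 0 ≤ s) : 1 / (1 + s) ∈ Set.Icc (0 : ℝ) 1 :=
  ⟨by positivity, by rw [div_le_one (by positivity)]; linarith⟩

theorem integrable_coeFn (q : L2Unit) : Integrable q unitMeasure :=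
  (Lp.memLp q).integrable (by norm_num)

theorem inner_toLp_eq (q : L2Unit) {f : ℝ → ℂ} (hf : MemLp f 2 unitMeasure) :
    ⟪q, hf.toLp⟫ = (∫ x, q x * (starRingEnd ℂ) (f x) ∂unitMeasure).re :=
  inner_L2Unit_of_ae EventuallyEq.rfl hf.coeFn_toLp

/-- A vector is nonnegative on the closed cone if it is nonnegative on the Stieltjes kernels. -/
theorem inner_nonneg_iff {h : ℝ} (hh : 0 < h) (q : L2Unit) :
    (∀ z ∈ closure (admissibleTraces h), 0 ≤ ⟪q, z⟫) ↔ ∀ s, 0 ≤ s → 0 ≤ pairing h q s := by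
  constructor
  · intro hq s hs
    have hk := (isAdmissible_stieltjesKernel hh hs).isInClosure
    have h1 := hq _ (hk.toLp_mem hh)
    rw [inner_toLp_eq] at h1
    simp only [conj_stieltjesKernel, mul_one_div] at h1
    exact h1
  · intro hpos z hz
    refine closure_minimal (t := {z | 0 ≤ ⟪q, z⟫}) ?_
      (isClosed_le continuous_const (by fun_prop)) hz
    rintro z ⟨g, hg, hzg⟩
    rw [Set.mem_ofPred_eq, inner_L2Unit_of_ae EventuallyEq.rfl hzg]
    exact hg.re_integral_nonneg hh (integrable_coeFn q) hpos

/-- The classes in `L²(0, 1)` of the kernels. -/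
def kernelLp {h : ℝ} (hh : 0 < h) (θ : Set.Icc (0 : ℝ) 1) : L2Unit :=
  ((isInClosure_unitKernel hh θ.2).memLp hh).toLp

theorem inner_kernelLp {h : ℝ} (hh : 0 < h) (q : L2Unit) (θ : Set.Icc (0 : ℝ) 1) :
    ⟪q, kernelLp hh θ⟫ = unitPairing h q θ := by
  rw [kernelLp, inner_toLp_eq]
  simp only [conj_unitKernel, mul_one_div]
  rfl

theorem continuous_kernelLp {h : ℝ} (hh : 0 < h) : Continuous (kernelLp hh) := by
  set M := 1 + (1 + h) ^ 2
  refine (LipschitzWith.of_dist_le' (K := M * kernelBound h ^ 2) fun θ η => ?_).continuous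
  rw [dist_eq_norm, kernelLp, kernelLp, ← MemLp.toLp_sub]
  have hθm := (isInClosure_unitKernel hh θ.2).memLp hh
  have hηm := (isInClosure_unitKernel hh η.2).memLp hh
  have hbd : ∀ᵐ x ∂unitMeasure, ‖((hθm.sub hηm).toLp _ : L2Unit) x‖
      ≤ M * kernelBound h ^ 2 * dist θ η := by
    filter_upwards [(hθm.sub hηm).coeFn_toLp, ae_unitMeasure_mem] with x hx hx'
    rw [hx, Pi.sub_apply]
    have hB := kernelBound_pos h
    set z : ℂ := (x : ℂ) + Complex.I * h with hz
    have key : ∀ θ : Set.Icc (0 : ℝ) 1, 1 / kernelBound h ≤ ‖1 - ((θ : ℝ) : ℂ) * (1 + z ^ 2)‖ := by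
      intro θ
      rw [div_le_iff₀ hB, mul_comm]
      exact one_le_kernelBound_mul hh (by simpa [hz, abs_of_pos hx'.1] using hx'.2.le)
        (by simp [hz, abs_of_pos hh]) θ.2
    have hpos : 0 < 1 / kernelBound h := by positivity
    have h1 := key θ
    have h2 := key η
    have hn1 : 1 - ((θ : ℝ) : ℂ) * (1 + z ^ 2) ≠ 0 := norm_pos_iff.1 (hpos.trans_le h1)
    have hn2 : 1 - ((η : ℝ) : ℂ) * (1 + z ^ 2) ≠ 0 := norm_pos_iff.1 (hpos.trans_le h2)
    have hzM : ‖1 + z ^ 2‖ ≤ M := by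
      have hz1 : ‖z‖ ≤ 1 + h := by
        refine (norm_add_le _ _).trans ?_
        simp only [norm_mul, Complex.norm_I, one_mul, Complex.norm_real, Real.norm_eq_abs,
          abs_of_pos hh, abs_of_pos hx'.1]
        linarith [hx'.2]
      calc ‖1 + z ^ 2‖ ≤ 1 + ‖z‖ ^ 2 := by
            rw [← norm_pow, ← norm_one (α := ℂ)]; exact norm_add_le _ _
        _ ≤ 1 + (1 + h) ^ 2 := by gcongr
    have heq : unitKernel h θ x - unitKernel h η x = (((θ : ℝ) - (η : ℝ) : ℝ) : ℂ) * (1 + z ^ 2) /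
        ((1 - ((θ : ℝ) : ℂ) * (1 + z ^ 2)) * (1 - ((η : ℝ) : ℂ) * (1 + z ^ 2))) := by
      simp only [unitKernel, ← hz]
      rw [div_sub_div _ _ hn1 hn2]
      congr 1
      push_cast; ring
    rw [heq, norm_div, norm_mul, norm_mul, Complex.norm_real, Subtype.dist_eq, Real.dist_eq,
      Real.norm_eq_abs]
    have h3 : 1 / kernelBound h * (1 / kernelBound h) ≤ ‖1 - ((θ : ℝ) : ℂ) * (1 + z ^ 2)‖ *
        ‖1 - ((η : ℝ) : ℂ) * (1 + z ^ 2)‖ := mul_le_mul h1 h2 hpos.le (norm_nonneg _)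
    refine (div_le_div₀ (mul_nonneg (abs_nonneg _) ((norm_nonneg _).trans hzM))
      (mul_le_mul_of_nonneg_left hzM (abs_nonneg _)) (by positivity) h3).trans (le_of_eq ?_)
    field_simp
  have h2 := Lp.norm_le_of_ae_bound (by positivity) hbd
  simpa [Measure.real, measureUnivNNReal] using h2

/-- For `0 < x < h` all kernels have positive real part, so the indicator function of
`(0, min 1 h)` has a positive inner product with each of them. -/
theorem exists_inner_kernelLp_pos {h : ℝ} (hh : 0 < h) :
    ∃ e : L2Unit, ∀ θ, 0 < ⟪e, kernelLp hh θ⟫ := by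
  set a := min 1 h with ha
  have ha0 : 0 < a := lt_min one_pos hh
  set w : ℝ → ℂ := Set.indicator (Set.Ioo 0 a) 1 with hw
  have hwm : MemLp w 2 unitMeasure := by
    refine MemLp.of_bound ((measurable_one.indicator measurableSet_Ioo).aestronglyMeasurable) 1
      (Eventually.of_forall fun x => ?_)
    by_cases hx : x ∈ Set.Ioo 0 a <;> simp [hw, hx]
  refine ⟨hwm.toLp, fun θ => ?_⟩
  have hk := isInClosure_unitKernel hh θ.2
  have hc : Continuous fun x : ℝ => (starRingEnd ℂ) (unitKernel h θ x) :=
    Complex.continuous_conj.comp (continuousOn_comp_ofReal hh hk.1.continuousOn)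
  have h1 : ⟪(hwm.toLp : L2Unit), kernelLp hh θ⟫
      = ∫ x in (0 : ℝ)..a, ((starRingEnd ℂ) (unitKernel h θ x)).re := by
    rw [kernelLp, inner_L2Unit_of_ae hwm.coeFn_toLp (hk.memLp hh).coeFn_toLp]
    have h2 : ∀ x : ℝ, w x * (starRingEnd ℂ) (unitKernel h θ x)
        = Set.indicator (Set.Ioo 0 a) (fun x : ℝ => (starRingEnd ℂ) (unitKernel h θ x)) x := by
      intro x
      by_cases hx : x ∈ Set.Ioo 0 a <;> simp [hw, hx]
    simp_rw [h2]
    rw [integral_indicator measurableSet_Ioo, Measure.restrict_restrict measurableSet_Ioo,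
      Set.inter_eq_left.2 (Set.Ioo_subset_Ioo_right (min_le_left 1 h)),
      intervalIntegral.integral_of_le ha0.le, integral_Ioc_eq_integral_Ioo]
    have hi : Integrable (fun x : ℝ => (starRingEnd ℂ) (unitKernel h θ x))
        (volume.restrict (Set.Ioo 0 a)) :=
      (hc.continuousOn.integrableOn_compact isCompact_Icc).mono_set Set.Ioo_subset_Icc_self
    have := integral_re hi
    simp only [RCLike.re_eq_complex_re] at this
    exact this.symm
  rw [h1]
  refine intervalIntegral.intervalIntegral_pos_of_pos_on
    ((Complex.continuous_re.comp hc).intervalIntegrable _ _) (fun x hx => ?_) ha0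
  have hx1 : x < 1 := hx.2.trans_le (min_le_left _ _)
  have hxh : x < h := hx.2.trans_le (min_le_right _ _)
  have hD := norm_conj_unit_denom hh ⟨hx.1, hx1⟩ θ.2
  rw [conj_unitKernel, one_div, Complex.inv_re]
  set D := 1 - ((θ : ℝ) : ℂ) * (1 + ((x : ℂ) - Complex.I * h) ^ 2) with hDdef
  have hD0 : D ≠ 0 := by
    intro h0
    rw [h0, norm_zero, mul_zero] at hD
    linarith
  refine div_pos ?_ (Complex.normSq_pos.2 hD0)
  have hre : D.re = (1 - θ) + θ * (h ^ 2 - x ^ 2) := by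
    simp [hDdef, sq]; ring
  have h3 : 0 < h ^ 2 - x ^ 2 := by nlinarith [hx.1]
  rw [hre]
  rcases θ.2.1.eq_or_lt with h0 | h0
  · rw [← h0]; norm_num
  · have := mul_pos h0 h3
    linarith [θ.2.2]

/-- The nearest point of a closed convex set. -/
theorem exists_projection {K : Set L2Unit} (hK : Convex ℝ K) (hc : IsClosed K) (hne : K.Nonempty)
    (y : L2Unit) : ∃ p ∈ K, ∀ z ∈ K, ‖p - y‖ ≤ ‖z - y‖ := by
  obtain ⟨p, hp, hmin⟩ := exists_norm_eq_iInf_of_complete_convex hne hc.isComplete hK y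
  refine ⟨p, hp, fun z hz => ?_⟩
  rw [norm_sub_rev, norm_sub_rev z, hmin]
  exact ciInf_le ⟨0, by rintro _ ⟨w, rfl⟩; exact norm_nonneg _⟩ (⟨z, hz⟩ : K)

theorem notMem_closure_of_iInf_ne_zero {h : ℝ} (hh : 0 < h) {fexp : ℝ → ℂ}
    (hfexp : MemLp fexp 2 unitMeasure)
    (hinf : (⨅ (f : ℂ → ℂ) (_ : IsAdmissible h f), l2Dist f fexp) ≠ 0) :
    (hfexp.toLp : L2Unit) ∉ closure (admissibleTraces h) := by
  intro hmem
  obtain ⟨ε, hε0, hε⟩ := ENNReal.lt_iff_exists_nnreal_btwn.1 (pos_iff_ne_zero.2 hinf)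
  rw [ENNReal.coe_pos] at hε0
  obtain ⟨z, ⟨g, hg, hzg⟩, hz⟩ := Metric.mem_closure_iff.1 hmem ε (by exact_mod_cast hε0)
  have h2 : z = (hg.isInClosure.memLp hh).toLp :=
    Lp.ext (hzg.trans (hg.isInClosure.memLp hh).coeFn_toLp.symm)
  have h3 : l2Dist g fexp ≤ ε := by
    rw [l2Dist_eq hh hg.isInClosure hfexp, ← h2, ← dist_eq_norm, dist_comm]
    exact ENNReal.ofReal_le_of_le_toReal (by simpa using hz.le)
  exact absurd ((iInf₂_le g hg).trans h3) (not_le.2 hε)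

/-- Sorting the nodes and dropping the vanishing weights. -/
theorem exists_rationalForm_eq (h : ℝ) (Z : Finset (Set.Icc (0 : ℝ) 1)) (c : Set.Icc (0 : ℝ) 1 → ℝ)
    (hc : ∀ θ, 0 ≤ c θ) :
    ∃ (N : ℕ) (ρ : ℝ) (σ t : Fin N → ℝ), IsParameter ρ σ t ∧
      ∀ ω, ∑ θ ∈ Z, (c θ : ℂ) * unitKernel h θ ω = rationalForm h ρ σ t ω := by
  classical
  -- the node belonging to `θ`, and the weight as a function of the node
  set τ : Set.Icc (0 : ℝ) 1 → ℝ := fun θ => 1 / (θ : ℝ) - 1 with hτ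
  set w : ℝ → ℝ := fun t => c (Set.projIcc 0 1 zero_le_one (1 / (1 + t))) * (1 + t) with hw
  set Z' := Z.filter fun θ : Set.Icc (0 : ℝ) 1 => 0 < (θ : ℝ) ∧ 0 < c θ with hZ'
  set T := Z'.image τ with hT
  have hwτ : ∀ θ : Set.Icc (0 : ℝ) 1, w (τ θ) = c θ * (1 / (θ : ℝ)) := by
    intro θ
    simp only [hw, hτ, add_sub_cancel, one_div_one_div, Set.projIcc_val]
  have hinj : Set.InjOn τ (Z' : Set (Set.Icc (0 : ℝ) 1)) := by
    intro θ _ η _ hθη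
    have h1 : 1 / (θ : ℝ) = 1 / (η : ℝ) := sub_left_injective hθη
    rw [one_div, one_div, inv_inj] at h1
    exact Subtype.ext h1
  refine ⟨T.card, ∑ θ ∈ Z.filter (fun θ : Set.Icc (0 : ℝ) 1 => (θ : ℝ) = 0), c θ, fun j => w (T.orderEmbOfFin rfl j),
    fun j => T.orderEmbOfFin rfl j,
    ⟨Finset.sum_nonneg fun θ _ => hc θ, fun j => ?_, fun j => ?_,
      (T.orderEmbOfFin rfl).strictMono⟩, fun ω => ?_⟩
  · obtain ⟨θ, hθ, hθj⟩ := Finset.mem_image.1 (T.orderEmbOfFin_mem rfl j)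
    have hθ' := (Finset.mem_filter.1 hθ).2
    simp only
    rw [← hθj, hwτ]
    exact mul_pos hθ'.2 (one_div_pos.2 hθ'.1)
  · obtain ⟨θ, hθ, hθj⟩ := Finset.mem_image.1 (T.orderEmbOfFin_mem rfl j)
    have hθ' := (Finset.mem_filter.1 hθ).2
    simp only
    rw [← hθj, hτ]
    have := θ.2.2
    simp only [sub_nonneg]
    rw [le_div_iff₀ hθ'.1]; linarith
  · rw [rationalForm_eq, ← Finset.sum_filter_add_sum_filter_not Z (fun θ : Set.Icc (0 : ℝ) 1 => (θ : ℝ) = 0)]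
    congr 1
    · push_cast
      refine Finset.sum_congr rfl fun θ hθ => ?_
      rw [(Finset.mem_filter.1 hθ).2, unitKernel_zero, mul_one]
    · have h1 : ∑ j, (w (T.orderEmbOfFin rfl j) : ℂ) * stieltjesKernel h (T.orderEmbOfFin rfl j) ω
          = ∑ t ∈ T, (w t : ℂ) * stieltjesKernel h t ω := by
        conv_rhs => rw [← Finset.map_orderEmbOfFin_univ T rfl]
        rw [Finset.sum_map]
        rfl
      rw [h1, hT, Finset.sum_image hinj]
      symm
      have hsub : Z' ⊆ Z.filter fun θ : Set.Icc (0 : ℝ) 1 => ¬ (θ : ℝ) = 0 := by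
        intro θ hθ
        rw [hZ', Finset.mem_filter] at hθ
        exact Finset.mem_filter.2 ⟨hθ.1, hθ.2.1.ne'⟩
      have h2 : ∑ θ ∈ Z', (c θ : ℂ) * unitKernel h θ ω
          = ∑ θ ∈ Z.filter fun θ : Set.Icc (0 : ℝ) 1 => ¬ (θ : ℝ) = 0, (c θ : ℂ) * unitKernel h θ ω := by
        refine Finset.sum_subset hsub fun θ hθ hθ' => ?_
        rw [Finset.mem_filter] at hθ
        have h0 : c θ = 0 := by
          by_contra hne
          exact hθ' (Finset.mem_filter.2 ⟨hθ.1, lt_of_le_of_ne θ.2.1 (Ne.symm hθ.2),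
            lt_of_le_of_ne (hc θ) (Ne.symm hne)⟩)
        simp [h0]
      rw [← h2]
      refine Finset.sum_congr rfl fun θ hθ => ?_
      have hθ' := (Finset.mem_filter.1 hθ).2
      rw [hwτ, unitKernel_eq hθ'.1]
      push_cast; ring

/-- The projection of `f_exp` onto the cone is the restriction of a rational function. -/
theorem exists_minimizer {h : ℝ} (hh : 0 < h) {fexp : ℝ → ℂ}
    (hfexp : MemLp fexp 2 unitMeasure)
    (hinf : (⨅ (f : ℂ → ℂ) (_ : IsAdmissible h f), l2Dist f fexp) ≠ 0) :
    ∃ (N : ℕ) (ρ : ℝ) (σ t : Fin N → ℝ), IsParameter ρ σ t ∧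
      IsMinimizer h fexp (rationalForm h ρ σ t) := by
  classical
  set K := closure (admissibleTraces h) with hKdef
  have hK : Convex ℝ K := (convex_admissibleTraces h).closure
  obtain ⟨p, hp, hmin⟩ := exists_projection hK isClosed_closure
    ⟨_, (isInClosure_one hh).toLp_mem hh⟩ hfexp.toLp
  set r : L2Unit := p - hfexp.toLp with hr
  obtain ⟨hrK, hrp⟩ := (norm_sub_le_iff_of_cone hK
    (fun a ha z hz => smul_mem_closure_admissibleTraces ha hz) hp _).1 hmin
  have hri := integrable_coeFn r
  -- otherwise `f_exp` itself would be a limit of admissible functions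
  obtain ⟨θ₀, hθ₀, hne⟩ : ∃ θ₀ ∈ Set.Icc (0 : ℝ) 1, unitPairing h r θ₀ ≠ 0 := by
    by_contra hcon
    push Not at hcon
    have h0 : r =ᵐ[unitMeasure] 0 := ae_eq_zero_of_pairing_eq_zero hh hri fun s hs => by
      have h1 := hcon _ (one_div_one_add_mem hs)
      rw [unitPairing_one_div h r hs] at h1
      exact (mul_eq_zero.1 h1).resolve_left (by positivity)
    have h1 : r = 0 := (Lp.eq_zero_iff_ae_eq_zero).2 h0
    rw [hr, sub_eq_zero] at h1
    exact notMem_closure_of_iInf_ne_zero hh hfexp hinf (h1 ▸ hp)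
  have hfin : {θ : Set.Icc (0 : ℝ) 1 | unitPairing h r θ = 0}.Finite :=
    ((finite_zeros_unitPairing hh hri hθ₀ hne).preimage Subtype.val_injective.injOn).subset
      fun θ hθ => ⟨θ.2, hθ⟩
  obtain ⟨e, he⟩ := exists_inner_kernelLp_pos hh
  obtain ⟨c, hc, hpc⟩ := exists_conicCombination (kernelLp hh) (continuous_kernelLp hh) p r e
    (fun q hq => (inner_nonneg_iff hh q).2 (fun s hs => by
      have h1 := hq ⟨_, one_div_one_add_mem hs⟩
      rw [inner_kernelLp, unitPairing_one_div h q hs] at h1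
      exact (mul_nonneg_iff_of_pos_left (by positivity)).1 h1) p hp)
    (fun θ => hrK _ ((isInClosure_unitKernel hh θ.2).toLp_mem hh)) hrp he hfin.toFinset
    (fun θ hθ => by
      rw [inner_kernelLp] at hθ
      exact hfin.mem_toFinset.2 hθ)
  obtain ⟨N, ρ, σ, t, hpar, heq⟩ := exists_rationalForm_eq h hfin.toFinset c hc
  refine ⟨N, ρ, σ, t, hpar, ?_⟩
  have hcl := isInClosure_rationalForm hh hpar
  rw [isMinimizer_iff hh hcl hfexp]
  have hpeq : (hcl.memLp hh).toLp = p := by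
    refine Lp.ext ((hcl.memLp hh).coeFn_toLp.trans ?_)
    rw [hpc]
    have h1 : ∀ᵐ x ∂unitMeasure, ∀ θ ∈ hfin.toFinset,
        (c θ • kernelLp hh θ) x = (c θ : ℂ) * unitKernel h θ x := by
      rw [Filter.eventually_all_finset]
      intro θ _
      filter_upwards [Lp.coeFn_smul (c θ) (kernelLp hh θ),
        ((isInClosure_unitKernel hh θ.2).memLp hh).coeFn_toLp] with x h2 h3
      rw [h2, Pi.smul_apply, kernelLp, h3, Complex.real_smul]
    filter_upwards [h1, Lp.coeFn_fun_finsetSum hfin.toFinset fun θ => c θ • kernelLp hh θ] with x h2 h3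
    rw [h3, ← heq]
    exact (Finset.sum_congr rfl h2).symm
  rw [hpeq]
  exact hmin

theorem caprini_eq {h : ℝ} {fexp : ℝ → ℂ} {f : ℂ → ℂ} (s : ℝ) :
    caprini h fexp f s = 2 * pairing h (fun x => f x - fexp x) s := by
  rw [caprini, intervalIntegral_eq_unitMeasure, pairing]

theorem tendsto_mul_caprini {h : ℝ} (hh : 0 < h) {fexp : ℝ → ℂ} {f : ℂ → ℂ}
    (hint : Integrable (fun x : ℝ => f x - fexp x) unitMeasure) :
    Tendsto (fun s : ℝ => s * caprini h fexp f s) atTop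
      (𝓝 (2 * (∫ x in (0 : ℝ)..1, (f (x : ℂ) - fexp x)).re)) := by
  rw [intervalIntegral_eq_unitMeasure]
  have h1 := ((Complex.continuous_re.tendsto _).comp (tendsto_mul_pairing hh hint)).const_mul 2
  refine h1.congr fun s => ?_
  rw [caprini_eq, Function.comp_apply, Complex.re_ofReal_mul, pairing]
  ring

theorem inner_rationalForm {h : ℝ} (hh : 0 < h) {N : ℕ} {ρ : ℝ} {σ t : Fin N → ℝ}
    (hpar : IsParameter ρ σ t) (q : L2Unit) :
    ⟪q, ((isInClosure_rationalForm hh hpar).memLp hh).toLp⟫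
      = ρ * (∫ x, q x ∂unitMeasure).re + ∑ j, σ j * pairing h q (t j) := by
  have hk := fun j => ((isAdmissible_stieltjesKernel hh (hpar.2.2.1 j)).isInClosure.memLp hh)
  have h1m := (isInClosure_one hh).memLp hh
  have hsum : ((isInClosure_rationalForm hh hpar).memLp hh).toLp
      = ρ • (h1m.toLp : L2Unit) + ∑ j, σ j • ((hk j).toLp : L2Unit) := by
    refine Lp.ext (((isInClosure_rationalForm hh hpar).memLp hh).coeFn_toLp.trans ?_)
    have h1 : ∀ᵐ x ∂unitMeasure, ∀ j ∈ (Finset.univ : Finset (Fin N)),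
        (σ j • ((hk j).toLp : L2Unit)) x = (σ j : ℂ) * stieltjesKernel h (t j) x := by
      rw [Filter.eventually_all_finset]
      intro j _
      filter_upwards [Lp.coeFn_smul (σ j) ((hk j).toLp : L2Unit), (hk j).coeFn_toLp] with x h2 h3
      rw [h2, Pi.smul_apply, h3, Complex.real_smul]
    filter_upwards [h1, Lp.coeFn_fun_finsetSum Finset.univ fun j => σ j • ((hk j).toLp : L2Unit),
      Lp.coeFn_add (ρ • (h1m.toLp : L2Unit)) (∑ j, σ j • ((hk j).toLp : L2Unit)),
      Lp.coeFn_smul ρ (h1m.toLp : L2Unit), h1m.coeFn_toLp] with x h2 h3 h4 h5 h6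
    rw [h4, Pi.add_apply, h3, Finset.sum_congr rfl h2, h5, Pi.smul_apply, h6,
      rationalForm_eq, Complex.real_smul, mul_one]
  rw [hsum, inner_add_right, inner_sum, real_inner_smul_right, inner_toLp_eq]
  simp only [map_one, mul_one]
  congr 1
  refine Finset.sum_congr rfl fun j _ => ?_
  rw [real_inner_smul_right, inner_toLp_eq]
  simp only [conj_stieltjesKernel, mul_one_div]
  rfl

/-- The variational inequality for the projection, written with the generators of the cone. -/
theorem isMinimizer_rationalForm_iff {h : ℝ} (hh : 0 < h) {fexp : ℝ → ℂ}
    (hfexp : MemLp fexp 2 unitMeasure) {N : ℕ} {ρ : ℝ} {σ t : Fin N → ℝ}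
    (hpar : IsParameter ρ σ t) :
    IsMinimizer h fexp (rationalForm h ρ σ t) ↔
      (∀ s, 0 ≤ s → 0 ≤ pairing h (fun x => rationalForm h ρ σ t x - fexp x) s) ∧
      ρ * (∫ x, (rationalForm h ρ σ t (x : ℂ) - fexp x) ∂unitMeasure).re +
        ∑ j, σ j * pairing h (fun x => rationalForm h ρ σ t x - fexp x) (t j) = 0 := by
  have hcl := isInClosure_rationalForm hh hpar
  set q : L2Unit := (hcl.memLp hh).toLp - hfexp.toLp with hq
  have hqe : q =ᵐ[unitMeasure] fun x => rationalForm h ρ σ t x - fexp x := by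
    rw [hq, ← MemLp.toLp_sub]
    exact MemLp.coeFn_toLp _
  have h1 : ∀ s, pairing h (fun x => rationalForm h ρ σ t x - fexp x) s = pairing h q s := by
    intro s
    unfold pairing
    congr 1
    refine integral_congr_ae ?_
    filter_upwards [hqe] with x hx
    rw [hx]
  rw [isMinimizer_iff hh hcl hfexp, norm_sub_le_iff_of_cone (convex_admissibleTraces h).closure
    (fun a ha z hz => smul_mem_closure_admissibleTraces ha hz) (hcl.toLp_mem hh),
    inner_nonneg_iff hh, inner_rationalForm hh hpar, ← integral_congr_ae hqe]
  simp only [h1]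
  rfl

end Permittivity

end

theorem theorem4p6 (h : ℝ) (hh : 0 < h) (fexp : ℝ → ℂ)
    (hfexp : MemLp fexp 2 (volume.restrict (Set.Ioo (0 : ℝ) 1)))
    (hinf : (⨅ (f : ℂ → ℂ) (_ : Permittivity.IsAdmissible h f),
      Permittivity.l2Dist f fexp) ≠ 0) :
    -- there is a minimizer, it is unique as a function on the half-plane, and it is rational
    (∃ f : ℂ → ℂ, Permittivity.IsMinimizer h fexp f ∧
      (∀ g : ℂ → ℂ, Permittivity.IsMinimizer h fexp g →
        Set.EqOn g f (Permittivity.halfPlane h)) ∧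
      ∃ (N : ℕ) (ρ : ℝ) (σ t : Fin N → ℝ), Permittivity.IsParameter ρ σ t ∧
        Set.EqOn f (Permittivity.rationalForm h ρ σ t) (Permittivity.halfPlane h)) ∧
    -- characterization of the minimizer through the Caprini function
    (∀ (N : ℕ) (ρ : ℝ) (σ t : Fin N → ℝ), Permittivity.IsParameter ρ σ t →
      (Permittivity.IsMinimizer h fexp (Permittivity.rationalForm h ρ σ t) ↔
        ((∀ s : ℝ, 0 ≤ s →
            0 ≤ Permittivity.caprini h fexp (Permittivity.rationalForm h ρ σ t) s) ∧
          (∀ j, Permittivity.caprini h fexp (Permittivity.rationalForm h ρ σ t) (t j) = 0) ∧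
          (0 < ρ → Tendsto
            (fun s : ℝ => s * Permittivity.caprini h fexp (Permittivity.rationalForm h ρ σ t) s)
            atTop (𝓝 0)))) ∧
      -- the value at infinity of the Caprini function
      Tendsto
        (fun s : ℝ => s * Permittivity.caprini h fexp (Permittivity.rationalForm h ρ σ t) s)
        atTop
        (𝓝 (2 * (∫ x in (0 : ℝ)..1,
          (Permittivity.rationalForm h ρ σ t (x : ℂ) - fexp x)).re))) := by
  open Permittivity in
  constructor
  · obtain ⟨N, ρ, σ, t, hpar, hmin⟩ := exists_minimizer hh hfexp hinf
    refine ⟨rationalForm h ρ σ t, hmin, fun g hg => ?_, N, ρ, σ, t, hpar, fun _ _ => rfl⟩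
    refine eqOn_halfPlane_of_toLp_eq hh hg.1 hmin.1 ?_
    exact eq_of_norm_sub_le (convex_admissibleTraces h).closure (hg.1.toLp_mem hh)
      (hmin.1.toLp_mem hh) hfexp.toLp ((isMinimizer_iff hh hg.1 hfexp).1 hg)
      ((isMinimizer_iff hh hmin.1 hfexp).1 hmin)
  · intro N ρ σ t hpar
    have hint : Integrable (fun x : ℝ => rationalForm h ρ σ t x - fexp x) unitMeasure :=
      (((isInClosure_rationalForm hh hpar).memLp hh).sub hfexp).integrable (by norm_num)
    have hlim := tendsto_mul_caprini hh hint
    refine ⟨?_, hlim⟩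
    rw [isMinimizer_rationalForm_iff hh hfexp hpar]
    rw [intervalIntegral_eq_unitMeasure] at hlim
    simp only [caprini_eq] at hlim ⊢
    set L := (∫ x, (rationalForm h ρ σ t (x : ℂ) - fexp x) ∂unitMeasure).re with hL
    set c := pairing h (fun x => rationalForm h ρ σ t x - fexp x) with hc
    obtain ⟨hρ, hσ, ht, -⟩ := hpar
    have hpos : (∀ s, 0 ≤ s → 0 ≤ 2 * c s) ↔ ∀ s, 0 ≤ s → 0 ≤ c s :=
      forall₂_congr fun s _ => by rw [mul_nonneg_iff_of_pos_left two_pos]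
    have hz : Tendsto (fun s => s * (2 * c s)) atTop (𝓝 0) ↔ L = 0 := by
      constructor
      · intro h0
        have := tendsto_nhds_unique h0 hlim
        linarith
      · intro h0
        rwa [h0, mul_zero] at hlim
    rw [hpos, hz]
    refine and_congr_right fun hnn => ?_
    -- the limit at infinity inherits the sign of the Caprini function
    have hL0 : 0 ≤ L := by
      have : 0 ≤ 2 * L := ge_of_tendsto hlim (by
        filter_upwards [eventually_ge_atTop 0] with s hs
        exact mul_nonneg hs (mul_nonneg zero_le_two (hnn s hs)))
      linarith
    have hterm : ∀ j ∈ Finset.univ, 0 ≤ σ j * c (t j) := fun j _ =>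
      mul_nonneg (hσ j).le (hnn _ (ht j))
    rw [add_eq_zero_iff_of_nonneg (mul_nonneg hρ hL0) (Finset.sum_nonneg hterm),
      Finset.sum_eq_zero_iff_of_nonneg hterm]
    constructor
    · rintro ⟨h1, h2⟩
      refine ⟨fun j => ?_, fun hρ0 => (mul_eq_zero.1 h1).resolve_left hρ0.ne'⟩
      rw [(mul_eq_zero.1 (h2 j (Finset.mem_univ j))).resolve_left (hσ j).ne', mul_zero]
    · rintro ⟨h1, h2⟩
      refine ⟨?_, fun j _ => ?_⟩
      · rcases hρ.eq_or_lt with h0 | h0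
        · rw [← h0, zero_mul]
        · rw [h2 h0, mul_zero]
      · rw [(mul_eq_zero.1 (h1 j)).resolve_left two_ne_zero, mul_zero]
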